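/- Let $k$ be an $F$-finite field of characteristic $p>0$, fix an isomorphism $k\cong F^!k=\mathrm{Hom}_k(F_*k,k)$, and let $\kappa_k:F_*k\to k$ be the corresponding map. Let $R=k[x]$, let $(\omega_R,\kappa)$ be the induced Cartier module, i.e. $\omega_R=\Omega_{R/k}=R\,dx$ with $\kappa(r x^n dx)=\kappa_k(r)\,x^{\frac{n+1}{p}-1}dx$ for $r\in k$ (zero if $p\nmid n+1$), and equip $\omega_{R[t]}=R[t]\,dt\otimes dx$ with the analogous Cartier structure. Let $i:\operatorname{Spec}R\to\operatorname{Spec}R[t]$, $t\mapsto x$, be the graph embedding. For a coherent Cartier module $(M,\kappa)$ over a ring $A$, $f\in A$ and $s\in\mathbb Q_{\ge0}$, let $\mathcal C$ be the Cartier algebra generated in degree $e$ by $\kappa^e f^{\lceil sp^e\rceil}$; the test module $\tau(M,f^s)$ is the smallest $\mathcal C$-submodule of $M$ that agrees with $\underline M=(\mathcal C_+)^hM$ $(h\gg0)$ at the generic points of $\operatorname{Supp}\underline M$. Let $\mathcal M=\operatorname{colim}_e (F^e)^!M$, where $(F^e)^!M=\mathrm{Hom}_A(F^e_*A,M)$ and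 the transition maps are induced by $M\to F^!M$, $m\mapsto[r\mapsto\kappa(rm)]$; let $\tau(\mathcal M,f^s)$ be the image of $\tau(M,f^s)$ in $\mathcal M$. If $C:\mathcal M\to F^!\mathcal M$ is bijective, then $\mathcal N=\mathcal M\otimes\omega_A^{-1}=\mathrm{Hom}_A(\omega_A,\mathcal M)$ is a unit $F$-module, whose structural map $\alpha:\mathcal N\to F_*\mathcal N$ sends $n$ to the unique $A$-linear $n'$ with $\kappa_{\mathcal M}\circ n'=n\circ\kappa_{\omega_A}$. Let $(\mathcal N,\alpha)$ be a unit $F$-module over a noetherian ring $A$ of characteristic $p$ and let $I=(f)\subseteq A$. A super-specializing $V$-filtration of $\mathcal N$ along $I$ (in the sense of Stadnik) is an exhaustive, separated, discrete, left-continuous decreasing $\mathbb Q$-indexed filtration by submodules $V^\cdot$ such that, with $Gr^i=V^i/\bigcup_{j>i}V^j$: (i) $V^0$ is coherent; (ii) $IV^i=V^{i+1}$ for $i\ne-1$; (iii) $\alpha(V^i)\subseteq V^{ip}$ for all $i$; (iv) for all $i$ with $Gr^i\neq0$ the map induced by $\alpha$ is an isomorphism $F_{A/I}^*Gr^i\cong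 Gr^{ip}$; (v) multiplication by $f$ induces isomorphisms $Gr^i\cong Gr^{i+1}$ for $i\neq-1$. Then the following hold. 1. For all $s\in\mathbb Q_{\ge0}$ the test modules $\tau(i_*\omega_R,t^s)$ and $\tau(\omega_R,x^s)$ exist, and $\tau(i_*\omega_R,t^s)=i_*\tau(\omega_R,x^s)=x^{\lfloor s\rfloor}\,i_*\omega_R$. 2. For $M=i_*\omega_R$ the map $C:\mathcal M\to F^!\mathcal M$ is bijective, and $\mathcal N=\mathcal M\otimes\omega_{R[t]}^{-1}$ is a unit $F$-module. There is an $R[t]$-linear isomorphism $\mathcal N\cong i_+R:=R[t]_{x-t}/R[t]$ under which $\alpha$ becomes the map $[z]\mapsto[z^p]$ induced by the Frobenius of $R[t]_{x-t}$, and under which the natural map $i_*\omega_R\otimes\omega_{R[t]}^{-1}\to\mathcal N$ becomes $r\mapsto\frac r{x-t}$ (that is, the homomorphism $\omega_{R[t]}\to\mathcal M$ sending $dt\otimes dx$ to the image of $r\,dx$ corresponds to $\frac{r}{x-t}$). For $s\in\mathbb{Q}_{\ge 0}$, the submodule $\tau(\mathcal M,t^s)\otimes\omega_{R[t]}^{-1}$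 corresponds to $R[t]\frac{x^{\lfloor s\rfloor}}{x-t}$. Hence, for every rational $s>-1$ and all $0<\varepsilon\ll1$ (depending on $s$), $\tau(\mathcal M,t^{s+1-\varepsilon})\otimes\omega_{R[t]}^{-1}$ corresponds to $R[t]\frac{x^{\lceil s\rceil}}{x-t}$. 3. Let $V^\cdot$ be any $\mathbb Q$-indexed family of submodules of $\mathcal N$ such that for every rational $s\ge0$ one has $V^s=\tau(\mathcal M,t^{s+1-\varepsilon})\otimes\omega_{R[t]}^{-1}$ for all $0<\varepsilon\ll1$. Then $V^\cdot$ is not a super-specializing $V$-filtration of $\mathcal N$ along $(t)$. More precisely: (a) axiom (iii) fails for every $i=s\in\mathbb N=\{0,1,2,\dots\}$, that is, $\alpha(V^s)\not\subseteq V^{sp}$; (b) axiom (iv) fails for $i=0$: one has $Gr^0\ne0$, and there is not even an abstract $R[t]/(t)$-linear isomorphism $F_{R[t]/(t)}^*Gr^0\cong Gr^0$. 4. For every $s\in\mathbb N$ one has $x^{sp}\notin(x^p-t^p,\;x^{sp}(x-t)^{p-1})$ and $x^{sp}\notin(t^p,\;x^{sp}t^{p-1})$ in $k[x,t]$. 5.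 On the Cartier side, for $0<\varepsilon\ll1$ let $Gr^1 i_*\omega_R=\tau(i_*\omega_R,t^{1-\varepsilon})/\tau(i_*\omega_R,t^1)$ with the Cartier structure over $k[x]$ induced by $\kappa\, t^{p-1}$. The natural map $Gr^1i_*\omega_R\to F^!_{k[x]}Gr^1i_*\omega_R=\mathrm{Hom}_{k[x]}(F_*k[x],Gr^1i_*\omega_R)$ is not surjective. -/

import Mathlib

open Polynomial TensorProduct

noncomputable section

/-! ### Cartier modules -/

/-- A Cartier structure on an `A`-module `M`: an `A`-linear map `κ : F_* M → M`, i.e. an additive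
map `κ : M → M` with `κ (a ^ p • m) = a • κ m`. -/
structure CartierMap (p : ℕ) (A M : Type*) [CommRing A] [AddCommGroup M] [Module A M]
    extends M →+ M where
  map_pow_smul' : ∀ (a : A) (m : M), toFun (a ^ p • m) = a • toFun m

namespace CartierMap

section basic

variable {p : ℕ} {A M : Type*} [CommRing A] [AddCommGroup M] [Module A M]

instance : FunLike (CartierMap p A M) M M where
  coe κ := κ.toFun
  coe_injective κ κ' h := by
    cases κ; cases κ'; congr 1; exact AddMonoidHom.ext (congrFun h)

instance : AddMonoidHomClass (CartierMap p A M) M M where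
  map_add κ := κ.toAddMonoidHom.map_add
  map_zero κ := κ.toAddMonoidHom.map_zero

theorem map_pow_smul (κ : CartierMap p A M) (a : A) (m : M) : κ (a ^ p • m) = a • κ m :=
  κ.map_pow_smul' a m

/-- The iterate `κ ^ e : M → M` as an additive map. -/
def iter (κ : CartierMap p A M) : ℕ → (M →+ M)
  | 0 => AddMonoidHom.id M
  | e + 1 => κ.toAddMonoidHom.comp (κ.iter e)

theorem iter_add (κ : CartierMap p A M) (d e : ℕ) (m : M) :
    κ.iter (d + e) m = κ.iter d (κ.iter e m) := by
  induction d with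
  | zero => simp [iter]
  | succ d ih => rw [Nat.succ_add]; exact congrArg κ ih

theorem iter_pow_smul (κ : CartierMap p A M) (e : ℕ) (a : A) (m : M) :
    κ.iter e (a ^ p ^ e • m) = a • κ.iter e m := by
  induction e generalizing a with
  | zero => simp [iter]
  | succ e ih =>
    have h : a ^ p ^ (e + 1) = (a ^ p) ^ p ^ e := by rw [← pow_mul, pow_succ, mul_comm]
    rw [h]
    change κ (κ.iter e _) = a • κ (κ.iter e m)
    rw [ih, κ.map_pow_smul]

/-- Transport of a Cartier structure along a linear isomorphism. -/
def transport {M' : Type*} [AddCommGroup M'] [Module A M'] (e : M' ≃ₗ[A] M)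
    (κ : CartierMap p A M) : CartierMap p A M' where
  toFun m := e.symm (κ (e m))
  map_zero' := by simp
  map_add' := by simp
  map_pow_smul' a m := by
    rw [map_smul, map_pow_smul, map_smul]

end basic

section testModule

variable {p : ℕ} {A M : Type*} [CommRing A] [AddCommGroup M] [Module A M]

/-- `𝒞₊ N`, where `𝒞` is the Cartier algebra generated in degree `e` by `κ ^ e f ^ ⌈t p ^ e⌉`:
the submodule generated by all `κ ^ e (f ^ ⌈t p ^ e⌉ n)` with `e ≥ 1` and `n ∈ N`. -/
def plus (κ : CartierMap p A M) (f : A) (t : ℚ) (N : Submodule A M) : Submodule A M :=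
  Submodule.span A
    {y | ∃ e : ℕ, 1 ≤ e ∧ ∃ n ∈ N, y = κ.iter e (f ^ ⌈t * (p : ℚ) ^ e⌉₊ • n)}

/-- The stable value `M̲ = (𝒞₊) ^ h M`, `h ≫ 0`, of the descending chain
`M ⊇ 𝒞₊ M ⊇ (𝒞₊) ^ 2 M ⊇ …`, written as the intersection of the chain. -/
def stable (κ : CartierMap p A M) (f : A) (t : ℚ) : Submodule A M :=
  ⨅ h : ℕ, (κ.plus f t)^[h] ⊤

/-- The `𝒞`-submodules of `M` that agree with `M̲` at every generic point of its support. -/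
def testCandidates (κ : CartierMap p A M) (f : A) (t : ℚ) : Set (Submodule A M) :=
  {N | κ.plus f t N ≤ N ∧
    ∀ η : PrimeSpectrum A, Minimal (· ∈ Module.support A (κ.stable f t)) η →
      N.localized η.asIdeal.primeCompl = (κ.stable f t).localized η.asIdeal.primeCompl}

/-- The test module `τ(M, f ^ t)`: the smallest `𝒞`-submodule of `M` that generically agrees with
`M̲` (it is the smallest one whenever a smallest one exists). -/
def testModule (κ : CartierMap p A M) (f : A) (t : ℚ) : Submodule A M :=
  sInf (κ.testCandidates f t)

end testModule

end CartierMap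

/-! ### The functor `(F ^ e)^!` and the colimit `colim_e (F ^ e)^! M` -/

/-- `Hom_A(F^e_* B, M)` for an `A`-algebra `B`: additive maps `φ : B → M` with
`φ (a ^ (p ^ e) b) = a • φ b`. For `B = A` this is `(F ^ e)^! M`. -/
def FShriek (p e : ℕ) (A B M : Type*) [CommRing A] [CommRing B] [Algebra A B]
    [AddCommGroup M] [Module A M] : AddSubgroup (B →+ M) where
  carrier := {φ | ∀ (a : A) (b : B), φ (algebraMap A B a ^ p ^ e * b) = a • φ b}
  zero_mem' := by intro a b; simp
  add_mem' := by intro φ ψ hφ hψ a b; simp [hφ a b, hψ a b]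
  neg_mem' := by intro φ hφ a b; simp [hφ a b]

namespace FShriek

variable {p e : ℕ} {A B M : Type*} [CommRing A] [CommRing B] [Algebra A B]
  [AddCommGroup M] [Module A M]

instance : FunLike (FShriek p e A B M) B M where
  coe φ := φ.1
  coe_injective _ _ h := Subtype.ext (AddMonoidHom.ext (congrFun h))

instance : AddMonoidHomClass (FShriek p e A B M) B M where
  map_add φ := φ.1.map_add
  map_zero φ := φ.1.map_zero

@[ext] theorem ext {φ ψ : FShriek p e A B M} (h : ∀ b, φ b = ψ b) : φ = ψ :=
  DFunLike.ext _ _ h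

theorem map_pow_mul (φ : FShriek p e A B M) (a : A) (b : B) :
    φ (algebraMap A B a ^ p ^ e * b) = a • φ b := φ.2 a b

/-- The module structure is through the argument: `(a • φ) b = φ (a b)`. -/
instance : SMul A (FShriek p e A B M) where
  smul a φ := ⟨φ.1.comp (AddMonoidHom.mulLeft (algebraMap A B a)), fun c b => by
    change φ.1 (algebraMap A B a * (algebraMap A B c ^ p ^ e * b)) = c • φ.1 (algebraMap A B a * b)
    rw [← φ.2]; congr 1; ring⟩

@[simp] theorem smul_apply (a : A) (φ : FShriek p e A B M) (b : B) :
    (a • φ) b = φ (algebraMap A B a * b) := rfl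

@[simp] theorem add_apply (φ ψ : FShriek p e A B M) (b : B) : (φ + ψ) b = φ b + ψ b := rfl

@[simp] theorem zero_apply (b : B) : (0 : FShriek p e A B M) b = 0 := rfl

instance : Module A (FShriek p e A B M) where
  one_smul φ := by ext b; simp
  mul_smul a a' φ := by ext b; simp only [smul_apply, map_mul]; congr 1; ring
  smul_zero a := by ext b; simp
  smul_add a φ ψ := by ext b; simp
  add_smul a a' φ := by
    ext b; simp only [smul_apply, add_apply, map_add, add_mul]
  zero_smul φ := by ext b; simp

end FShriek

namespace CartierMap

variable {p : ℕ} {A M : Type*} [CommRing A] [AddCommGroup M] [Module A M]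

/-- The adjoint `C : M → F^! M`, `m ↦ [r ↦ κ (r m)]`, of the Cartier structure. -/
def adjoint (κ : CartierMap p A M) : M →ₗ[A] FShriek p 1 A A M where
  toFun m := ⟨κ.toAddMonoidHom.comp (LinearMap.toSpanSingleton A M m).toAddMonoidHom, fun a b => by
    change κ ((algebraMap A A a ^ p ^ 1 * b) • m) = a • κ (b • m)
    rw [pow_one, Algebra.algebraMap_self_apply, mul_smul, κ.map_pow_smul]⟩
  map_add' m n := by
    ext b
    change κ (b • (m + n)) = κ (b • m) + κ (b • n)
    simp
  map_smul' a m := by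
    ext b
    change κ (b • (a • m)) = κ ((a * b) • m)
    rw [smul_smul, mul_comm]

@[simp] theorem adjoint_apply (κ : CartierMap p A M) (m : M) (r : A) :
    κ.adjoint m r = κ (r • m) := rfl

/-- The map `(F ^ i)^! M → (F ^ j)^! M`, `φ ↦ κ ^ (j - i) ∘ φ`, for `i ≤ j`; for `j = i + 1` it is
`(F ^ i)^!` applied to the adjoint `C : M → F^! M`, under `(F ^ i)^! F^! M = (F ^ (i + 1))^! M`. -/
def transition (κ : CartierMap p A M) (i j : ℕ) (hij : i ≤ j) :
    FShriek p i A A M →ₗ[A] FShriek p j A A M where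
  toFun φ := ⟨(κ.iter (j - i)).comp φ.1, fun a b => by
    have h : algebraMap A A a ^ p ^ j = algebraMap A A (a ^ p ^ (j - i)) ^ p ^ i := by
      rw [map_pow, ← pow_mul, ← pow_add, Nat.sub_add_cancel hij]
    change κ.iter (j - i) (φ.1 _) = a • κ.iter (j - i) (φ.1 b)
    rw [h, φ.2, iter_pow_smul]⟩
  map_add' φ ψ := by
    ext b
    change κ.iter (j - i) (φ b + ψ b) = κ.iter (j - i) (φ b) + κ.iter (j - i) (ψ b)
    rw [map_add]
  map_smul' a φ := rfl

/-- The colimit `ℳ = colim_e (F ^ e)^! M`. -/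
abbrev Colim (κ : CartierMap p A M) : Type _ :=
  Module.DirectLimit (fun e : ℕ => FShriek p e A A M) κ.transition

/-- The canonical map `(F ^ e)^! M → ℳ`. -/
def toColimOf (κ : CartierMap p A M) (e : ℕ) : FShriek p e A A M →ₗ[A] κ.Colim :=
  Module.DirectLimit.of A ℕ (fun e : ℕ => FShriek p e A A M) κ.transition e

theorem toColimOf_transition (κ : CartierMap p A M) (i j : ℕ) (hij : i ≤ j)
    (φ : FShriek p i A A M) : κ.toColimOf j (κ.transition i j hij φ) = κ.toColimOf i φ :=
  Module.DirectLimit.of_f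

/-- `M = (F ^ 0)^! M`. -/
def toShriekZero (_κ : CartierMap p A M) : M →ₗ[A] FShriek p 0 A A M where
  toFun m := ⟨(LinearMap.toSpanSingleton A M m).toAddMonoidHom, fun a b => by
    change (algebraMap A A a ^ p ^ 0 * b) • m = a • b • m
    rw [pow_zero, pow_one, Algebra.algebraMap_self_apply, mul_smul]⟩
  map_add' m n := by
    ext b
    exact smul_add b m n
  map_smul' a m := by
    ext b
    change b • a • m = (a * b) • m
    rw [smul_smul, mul_comm]

/-- The natural map `M → ℳ`. -/
def toColim (κ : CartierMap p A M) : M →ₗ[A] κ.Colim :=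
  (κ.toColimOf 0).comp κ.toShriekZero

/-- The Cartier structure of `(F ^ e)^! M`, namely `φ ↦ κ ∘ φ ∘ F`. -/
def shriek (κ : CartierMap p A M) (e : ℕ) [Fact p.Prime] [CharP A p] :
    CartierMap p A (FShriek p e A A M) where
  toFun φ := ⟨(κ.toAddMonoidHom.comp φ.1).comp (frobenius A p).toAddMonoidHom, fun a b => by
    change κ (φ.1 ((algebraMap A A a ^ p ^ e * b) ^ p)) = a • κ (φ.1 (b ^ p))
    rw [mul_pow, ← pow_mul, mul_comm (p ^ e), pow_mul, ← map_pow, φ.2, map_pow_smul]⟩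
  map_zero' := by
    ext b
    exact map_zero κ
  map_add' φ ψ := by
    ext b
    exact map_add κ (φ (b ^ p)) (ψ (b ^ p))
  map_pow_smul' a φ := by
    ext b
    change κ (φ (a ^ p * b ^ p)) = κ (φ ((a * b) ^ p))
    rw [mul_pow]

variable [Fact p.Prime] [CharP A p]

/-- The map `C : ℳ → F^! ℳ` induced on the colimit by the adjoint structural maps
`(F ^ e)^! M → F^! (F ^ e)^! M`. -/
def colimAdjoint (κ : CartierMap p A M) : κ.Colim →ₗ[A] FShriek p 1 A A κ.Colim :=
  Module.DirectLimit.lift A ℕ (fun e : ℕ => FShriek p e A A M) κ.transition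
    (fun e =>
      { toFun := fun φ => ⟨(κ.toColimOf e).toAddMonoidHom.comp ((κ.shriek e).adjoint φ).1,
            fun a b => by
          have h := ((κ.shriek e).adjoint φ).2 a b
          rw [AddMonoidHom.comp_apply, AddMonoidHom.comp_apply, h]
          exact (κ.toColimOf e).map_smul _ _⟩
        map_add' := fun φ ψ => by
          ext b
          change κ.toColimOf e ((κ.shriek e).adjoint (φ + ψ) b) =
            κ.toColimOf e ((κ.shriek e).adjoint φ b) +
            κ.toColimOf e ((κ.shriek e).adjoint ψ b)
          rw [map_add, FShriek.add_apply, map_add]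
        map_smul' := fun a φ => by
          ext b
          change κ.toColimOf e ((κ.shriek e).adjoint (a • φ) b) =
            κ.toColimOf e ((κ.shriek e).adjoint φ (a * b))
          rw [map_smul]; rfl })
    (fun i j hij φ => by
      ext b
      change κ.toColimOf j (κ.shriek j (b • κ.transition i j hij φ)) =
        κ.toColimOf i (κ.shriek i (b • φ))
      rw [← κ.toColimOf_transition i j hij]
      congr 1
      ext c
      change κ (κ.iter (j - i) (φ (b * c ^ p))) = κ.iter (j - i) (κ (φ (b * c ^ p)))
      have h1 := κ.iter_add 1 (j - i) (φ (b * c ^ p))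
      have h2 := κ.iter_add (j - i) 1 (φ (b * c ^ p))
      rw [add_comm] at h1
      exact h1.symm.trans h2)

/-- The Cartier structure on `ℳ` (the one whose adjoint is `colimAdjoint`). -/
def colim (κ : CartierMap p A M) : CartierMap p A κ.Colim where
  toFun m := κ.colimAdjoint m 1
  map_zero' := by simp
  map_add' m n := by simp
  map_pow_smul' a m := by
    change κ.colimAdjoint (a ^ p • m) 1 = a • κ.colimAdjoint m 1
    rw [map_smul, ← FShriek.map_pow_mul, pow_one, ← map_pow]; rfl

/-- The test module filtration `τ(ℳ, f ^ t)`: the image of `τ(M, f ^ t)` in `ℳ`. -/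
def colimTestModule (κ : CartierMap p A M) (f : A) (t : ℚ) : Submodule A κ.Colim :=
  (κ.testModule f t).map κ.toColim

end CartierMap

/-! ### Unit `F`-modules -/

/-- A copy of the `A`-algebra `B`, regarded as an `A`-algebra through `A → B` preceded by the
Frobenius of `A`. For an `A`-module `N`, the tensor product `FrobAlg p A B ⊗[A] N` is
`F^* N` if `B = A`, and it is `F_{A/I}^* N` if `B = A ⧸ I` and `I N = 0`. -/
def FrobAlg (_p : ℕ) (_A B : Type*) : Type _ := B

namespace FrobAlg

variable (p : ℕ) (A B : Type*) [CommRing B]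

instance : CommRing (FrobAlg p A B) := inferInstanceAs (CommRing B)

/-- The identity `B = FrobAlg p A B`. -/
def of : B ≃+* FrobAlg p A B := RingEquiv.refl B

instance [CommRing A] [Algebra A B] [Fact p.Prime] [CharP A p] : Algebra A (FrobAlg p A B) :=
  ((of p A B).toRingHom.comp ((algebraMap A B).comp (frobenius A p))).toAlgebra

end FrobAlg

section UnitFModule

variable {p : ℕ} [Fact p.Prime] {A N : Type*} [CommRing A] [CharP A p] [AddCommGroup N] [Module A N]

/-- `(N, α)`, with `α : N → F_* N` given as a Frobenius-linear map, is a unit `F`-module: the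
linearization `F^* N → N`, `a ⊗ n ↦ a α(n)`, is bijective. -/
def IsUnitFModule (α : N →ₛₗ[frobenius A p] N) : Prop :=
  ∃ Φ : FrobAlg p A A ⊗[A] N ≃+ N, ∀ (a : A) (n : N), Φ (FrobAlg.of p A A a ⊗ₜ[A] n) = a • α n

/-- Let `(ω, κω)` be the dualizing module and let `(ℳ, κ)` be a unit Cartier module, i.e. one with
`C : ℳ ≅ F^! ℳ`. On `ℳ ⊗ ω⁻¹ = Hom_A(ω, ℳ)` the isomorphisms `C` and `ω ≅ F^! ω` induce a
Frobenius-linear map `α`: it sends `n : ω → ℳ` to the unique linear `n' : ω → ℳ` for which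
`κ ∘ n' = n ∘ κω`. -/
def IsAdjointStructuralMap {ω L : Type*} [AddCommGroup ω] [Module A ω] [AddCommGroup L] [Module A L]
    (κω : CartierMap p A ω) (κ : CartierMap p A L)
    (α : (ω →ₗ[A] L) →ₛₗ[frobenius A p] (ω →ₗ[A] L)) : Prop :=
  ∀ n n' : ω →ₗ[A] L, n' = α n ↔ ∀ w : ω, κ (n' w) = n (κω w)

/-- `T ⊗ ω⁻¹` as a submodule of `ℳ ⊗ ω⁻¹ = Hom_A(ω, ℳ)`, for a submodule `T` of `ℳ`. -/
def twistSubmodule (ω : Type*) {L : Type*} [AddCommGroup ω] [Module A ω] [AddCommGroup L]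
    [Module A L] (T : Submodule A L) : Submodule A (ω →ₗ[A] L) where
  carrier := {n | ∀ w, n w ∈ T}
  zero_mem' _ := T.zero_mem
  add_mem' h h' w := T.add_mem (h w) (h' w)
  smul_mem' a _ h w := T.smul_mem a (h w)

/-! ### `V`-filtrations -/

/-- `V^{>i} = ⋃_{j > i} V^j`. -/
def vAbove (V : ℚ → Submodule A N) (i : ℚ) : Submodule A N := ⨆ j : ℚ, ⨆ _ : i < j, V j

/-- The graded piece `Gr^i = V^i / V^{>i}`. -/
abbrev VGr (V : ℚ → Submodule A N) (i : ℚ) : Type _ :=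
  V i ⧸ (vAbove V i).submoduleOf (V i)

/-- The class in `Gr^i` of an element of `V^i`. -/
abbrev VGr.mk (V : ℚ → Submodule A N) (i : ℚ) : V i →ₗ[A] VGr V i :=
  ((vAbove V i).submoduleOf (V i)).mkQ

/-- Axiom (iii) at the index `i`: `α(V^i) ⊆ V^{ip}`. -/
def VFrobeniusStable (α : N →ₛₗ[frobenius A p] N) (V : ℚ → Submodule A N) (i : ℚ) : Prop :=
  ∀ m ∈ V i, α m ∈ V (i * p)

/-- Axiom (iv) at the index `i`: if `Gr^i ≠ 0`, then `α` induces a map `Gr^i → F_* Gr^{ip}` whose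
adjoint `F_{A/I}^* Gr^i → Gr^{ip}`, `a ⊗ [m] ↦ a [α m]`, is an isomorphism. Since `I Gr^i = 0` for
a `V`-filtration, `F_{A/I}^* Gr^i` is the base change of `Gr^i` along `A → A ⧸ I`, `a ↦ [a ^ p]`. -/
def VFrobeniusGraded (α : N →ₛₗ[frobenius A p] N) (I : Ideal A) (V : ℚ → Submodule A N) (i : ℚ) :
    Prop :=
  Nontrivial (VGr V i) →
    ∃ h : ∀ m : V i, α m ∈ V (i * p),
      ∃ Φ : FrobAlg p A (A ⧸ I) ⊗[A] VGr V i ≃+ VGr V (i * p),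
        ∀ (a : A) (m : V i),
          Φ (FrobAlg.of p A (A ⧸ I) (Ideal.Quotient.mk I a) ⊗ₜ[A] VGr.mk V i m) =
            a • VGr.mk V (i * p) ⟨α m, h m⟩

/-- `V` is a super-specializing `V`-filtration along `(f)` of the unit `F`-module `(N, α)`, where
`A` is noetherian: a decreasing exhaustive separated discrete left-continuous `ℚ`-indexed filtration
satisfying the axioms (i)-(v). -/
structure IsSuperSpecializing (α : N →ₛₗ[frobenius A p] N) (f : A) (V : ℚ → Submodule A N) :
    Prop where
  antitone : Antitone V
  exhaustive : ⨆ i, V i = ⊤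
  separated : ⨅ i, V i = ⊥
  discrete : ∀ a b : ℚ, (V '' Set.Icc a b).Finite
  left_continuous : ∀ i : ℚ, ∃ ε > 0, ∀ j : ℚ, i - ε ≤ j → j ≤ i → V j = V i
  coherent : (V 0).FG
  smul_eq : ∀ i : ℚ, i ≠ -1 → Ideal.span {f} • V i = V (i + 1)
  frobenius_stable : ∀ i : ℚ, VFrobeniusStable α V i
  frobenius_graded : ∀ i : ℚ, VFrobeniusGraded α (Ideal.span {f}) V i
  smul_graded : ∀ i : ℚ, i ≠ -1 →
    ∃ h : ∀ m : V i, f • (m : N) ∈ V (i + 1),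
      ∃ μ : VGr V i ≃ₗ[A] VGr V (i + 1),
        ∀ m : V i, μ (VGr.mk V i m) = VGr.mk V (i + 1) ⟨f • (m : N), h m⟩

end UnitFModule

/-! ### The dualizing modules of the affine line and plane, and the graph embedding -/

/-- For a Cartier structure `κ` on the ring `B`, the map `B[X] → B[X]` with
`r X ^ n ↦ κ(r) X ^ ((n + 1) / p - 1)`, which is zero unless `p ∣ n + 1`. -/
def lineFun {p : ℕ} {B : Type*} [CommRing B] (κ : CartierMap p B B) (f : B[X]) : B[X] :=
  ∑ j ∈ Finset.range (f.natDegree + 1), monomial j (κ (f.coeff (p * (j + 1) - 1)))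

theorem coeff_lineFun {p : ℕ} [hp : Fact p.Prime] {B : Type*} [CommRing B] (κ : CartierMap p B B)
    (f : B[X]) (j : ℕ) : (lineFun κ f).coeff j = κ (f.coeff (p * (j + 1) - 1)) := by
  simp only [lineFun, finsetSum_coeff, coeff_monomial]
  rw [Finset.sum_ite_eq' (Finset.range (f.natDegree + 1)) j]
  split_ifs with h
  · rfl
  · rw [coeff_eq_zero_of_natDegree_lt, map_zero]
    have h2 := hp.out.two_le
    have h3 : f.natDegree + 1 ≤ j := by simpa using h
    have h4 : 2 * (j + 1) ≤ p * (j + 1) := Nat.mul_le_mul_right _ h2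
    omega

/-- The Cartier structure `r X ^ n ↦ κ(r) X ^ ((n + 1) / p - 1)` on `B[X]`. -/
def lineCartier {p : ℕ} [hp : Fact p.Prime] {B : Type*} [CommRing B] [CharP B p]
    (κ : CartierMap p B B) : CartierMap p B[X] B[X] where
  toFun := lineFun κ
  map_zero' := by ext j; simp [coeff_lineFun]
  map_add' f g := by ext j; simp [coeff_lineFun]
  map_pow_smul' a f := by
    change lineFun κ (a ^ p • f) = a • lineFun κ f
    induction a using Polynomial.induction_on' with
    | add a b ha hb =>
      rw [add_pow_char, add_smul, add_smul, ← ha, ← hb]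
      ext j; simp [coeff_lineFun]
    | monomial n b =>
      ext j
      rw [coeff_lineFun, monomial_pow, smul_eq_mul, smul_eq_mul, ← C_mul_X_pow_eq_monomial,
        ← C_mul_X_pow_eq_monomial, mul_assoc, mul_assoc, coeff_C_mul, coeff_C_mul,
        coeff_X_pow_mul', coeff_X_pow_mul']
      have h2 := hp.out.pos
      by_cases h : n ≤ j
      · have h3 : n * p ≤ p * (j + 1) - 1 := by
          obtain ⟨d, rfl⟩ := Nat.exists_eq_add_of_le h
          have : p * (n + d + 1) = n * p + p * d + p := by ring
          omega
        have h4 : p * (j + 1) - 1 - n * p = p * (j - n + 1) - 1 := by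
          obtain ⟨d, rfl⟩ := Nat.exists_eq_add_of_le h
          have h5 : p * (n + d + 1) = n * p + p * (d + 1) := by ring
          rw [h5, Nat.add_sub_cancel_left]
          omega
        rw [if_pos h, if_pos h3, h4, coeff_lineFun, ← smul_eq_mul, κ.map_pow_smul, smul_eq_mul]
      · have h3 : ¬ n * p ≤ p * (j + 1) - 1 := by
          have h6 : p * (j + 1) ≤ p * n := Nat.mul_le_mul_left _ (by omega)
          have h7 : 0 < p * (j + 1) := by positivity
          rw [mul_comm n p]
          omega
        rw [if_neg h, if_neg h3, mul_zero, mul_zero, map_zero]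

section Omega

variable {p : ℕ} [Fact p.Prime] {k : Type*} [Field k] [CharP k p]

/-- The Cartier structure on `ω_R = Ω_{R/k}`, `R = k[x]`, induced by `k ≅ F^! k`:
`r x ^ n dx ↦ κ(r) x ^ ((n + 1) / p - 1) dx`. -/
def omegaLine (κ : CartierMap p k k) : CartierMap p k[X] (Ω[k[X]⁄k]) :=
  (lineCartier κ).transport (KaehlerDifferential.polynomialEquiv k)

variable (k) in
/-- `ω_{R[t]} = Ω_{R[t]/R} ⊗ (R[t] ⊗_R ω_R)`, the dualizing module of `R[t] = k[x][t]`; it is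
free on `dt ⊗ dx`. -/
abbrev OmegaPlane : Type _ := Ω[k[X][X]⁄k[X]] ⊗[k[X][X]] (k[X][X] ⊗[k[X]] Ω[k[X]⁄k])

variable (k) in
/-- The generator `dt ⊗ dx` of `ω_{R[t]}`. -/
def omegaPlaneGen : OmegaPlane k :=
  KaehlerDifferential.D k[X] k[X][X] X ⊗ₜ (1 ⊗ₜ KaehlerDifferential.D k k[X] X)

variable (k) in
/-- The trivialization `g dt ⊗ dx ↦ g` of `ω_{R[t]}`. -/
def omegaPlaneEquiv : OmegaPlane k ≃ₗ[k[X][X]] k[X][X] :=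
  (TensorProduct.congr (KaehlerDifferential.polynomialEquiv k[X])
    ((TensorProduct.AlgebraTensorModule.congr (LinearEquiv.refl k[X][X] k[X][X])
      (KaehlerDifferential.polynomialEquiv k)).trans
      (TensorProduct.AlgebraTensorModule.rid k[X] k[X][X] k[X][X]))).trans
    (TensorProduct.lid k[X][X] k[X][X])

variable (k) in
theorem omegaPlaneEquiv_gen : omegaPlaneEquiv k (omegaPlaneGen k) = 1 := by
  simp [omegaPlaneEquiv, omegaPlaneGen, KaehlerDifferential.polynomialEquiv_D]

/-- The Cartier structure on `ω_{R[t]}` induced by `k ≅ F^! k`: it sends `r x ^ i t ^ j dt ⊗ dx` to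
`κ(r) x ^ ((i + 1) / p - 1) t ^ ((j + 1) / p - 1) dt ⊗ dx`. -/
def omegaPlane (κ : CartierMap p k k) : CartierMap p k[X][X] (OmegaPlane k) :=
  (lineCartier (lineCartier κ)).transport (omegaPlaneEquiv k)

variable (k) in
/-- The pushforward `i_* ω_R` along the graph embedding `i : Spec R → Spec R[t]`, `t ↦ x`: the
module `ω_R` on which `R[t]` acts through `R[t] → R`, `t ↦ x`. -/
def GraphOmega : Type _ := Ω[k[X]⁄k]

namespace GraphOmega

instance : AddCommGroup (GraphOmega k) := inferInstanceAs (AddCommGroup (Ω[k[X]⁄k]))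

instance : Module k[X] (GraphOmega k) := inferInstanceAs (Module k[X] (Ω[k[X]⁄k]))

instance : Module k[X][X] (GraphOmega k) :=
  Module.compHom (GraphOmega k) (Polynomial.evalRingHom (X : k[X]))

theorem smul_def (g : k[X][X]) (m : GraphOmega k) : g • m = g.eval (X : k[X]) • m := rfl

instance : IsScalarTower k[X] k[X][X] (GraphOmega k) where
  smul_assoc r g m := by
    rw [smul_def, smul_def, Polynomial.eval_smul, smul_eq_mul, mul_smul]

variable (k) in
/-- The identity `ω_R = i_* ω_R` of the underlying `R`-modules. -/
def of : Ω[k[X]⁄k] ≃ₗ[k[X]] GraphOmega k := LinearEquiv.refl k[X] (Ω[k[X]⁄k])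

end GraphOmega

/-- The Cartier module `i_* ω_R`. -/
def graphOmega (κ : CartierMap p k k) : CartierMap p k[X][X] (GraphOmega k) where
  toFun m := GraphOmega.of k (omegaLine κ ((GraphOmega.of k).symm m))
  map_zero' := by simp
  map_add' := by simp
  map_pow_smul' g m := by
    rw [GraphOmega.smul_def, GraphOmega.smul_def, Polynomial.eval_pow, map_smul,
      CartierMap.map_pow_smul, map_smul]

/-- The unit `F`-module attached to `i_* ω_R`, as a module:
`colim_e (F ^ e)^! i_* ω_R ⊗ ω_{R[t]}⁻¹`. -/
abbrev GraphUnit (κ : CartierMap p k k) : Type _ := OmegaPlane k →ₗ[k[X][X]] (graphOmega κ).Colim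

/-- The test module filtration along `t` of the unit `F`-module attached to `i_* ω_R`:
`τ(colim_e (F ^ e)^! i_* ω_R, t ^ s) ⊗ ω_{R[t]}⁻¹`. -/
def graphTest (κ : CartierMap p k k) (s : ℚ) : Submodule k[X][X] (GraphUnit κ) :=
  twistSubmodule (OmegaPlane k) ((graphOmega κ).colimTestModule X s)

variable (k) in
/-- The element `x - t` of `R[t] = k[x][t]`. -/
abbrev xSubT : k[X][X] := C X - X

variable (k) in
/-- `i_+ R = R[t]_{x - t} / R[t]`. -/
abbrev IPlus : Type _ :=
  Localization.Away (xSubT k) ⧸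
    LinearMap.range (Algebra.linearMap k[X][X] (Localization.Away (xSubT k)))

variable (k) in
/-- The class in `i_+ R` of an element of `R[t]_{x - t}`. -/
abbrev IPlus.mk : Localization.Away (xSubT k) →ₗ[k[X][X]] IPlus k :=
  (LinearMap.range (Algebra.linearMap k[X][X] (Localization.Away (xSubT k)))).mkQ

/-- The class `g / (x - t)` in `i_+ R`. -/
def IPlus.frac (g : k[X][X]) : IPlus k :=
  IPlus.mk k (algebraMap k[X][X] _ g * IsLocalization.Away.invSelf (xSubT k))

end Omega

/-! ### Subquotients as Cartier modules -/

section SubQuotient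

variable {A M : Type*} [CommRing A] [AddCommGroup M] [Module A M]

/-- The quotient `T' / T` of two submodules `T ⊆ T'` of `M`. -/
def SubQuotient (T' T : Submodule A M) : Type _ := T' ⧸ T.submoduleOf T'

namespace SubQuotient

variable (T' T : Submodule A M)

instance : AddCommGroup (SubQuotient T' T) := inferInstanceAs (AddCommGroup (T' ⧸ T.submoduleOf T'))

instance {R : Type*} [CommRing R] [Algebra R A] [Module R M] [IsScalarTower R A M] :
    Module R (SubQuotient T' T) := inferInstanceAs (Module R (T' ⧸ T.submoduleOf T'))

/-- The class in `T' / T` of an element of `T'`. -/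
def mk (m : T') : SubQuotient T' T := (T.submoduleOf T').mkQ m

theorem mk_surjective : Function.Surjective (mk T' T) := Submodule.mkQ_surjective _

theorem smul_mk {R : Type*} [CommRing R] [Algebra R A] [Module R M] [IsScalarTower R A M]
    (r : R) (m : T') : r • mk T' T m = mk T' T (r • m) := rfl

end SubQuotient

/-- For a Cartier structure `κ` on the `A`-module `M` and an `R`-algebra `A`, the Cartier structure
`κ₁` over `R` on `T' / T` is induced by `κ f ^ n`. -/
def IsInducedCartier {p : ℕ} {R : Type*} [CommRing R] [Algebra R A] [Module R M]
    [IsScalarTower R A M] (κ : CartierMap p A M) (f : A) (n : ℕ) (T' T : Submodule A M)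
    (κ₁ : CartierMap p R (SubQuotient T' T)) : Prop :=
  ∀ m : T', ∃ h : κ (f ^ n • (m : M)) ∈ T',
    κ₁ (SubQuotient.mk T' T m) = SubQuotient.mk T' T ⟨κ (f ^ n • (m : M)), h⟩

end SubQuotient

end

/-!
Write `A = k[x][t]`, `f = x - t` and `M = i_* ω_R`. Everything is computed inside the local
cohomology module `A_f / A = i_+ R`, where `M` sits as the submodule killed by `f`, through
`r dx ↦ r / f`.

*The unit `F`-module.* Since `k` is `F`-finite and `κ` generates `F^! k`, there is a dual basis
`a = ∑ κ (c i a) ^ p b i` of `k`. It extends to `k[x]` and to `A` (`CartierMap.IsDualBasis.line`), and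
after localization to `A_f` and `A_f / A` (`AwayQuotient.isFrobeniusDual`). A dual basis makes
`A_f / A` a unit `F`-module under `z ↦ z ^ p` and, at the same time, a Cartier module isomorphic to
its `F^!`. The Cartier structure of `A_f / A` restricts to that of `M`, because
`κ(f ^ (p - 1) r) = κ(r)` modulo `f` (`lineCartier_xSubT_pow_mul_C`), and a power of it sends `A ν`
into `M` for every `ν`. Hence `colim_e (F ^ e)^! M` is `A_f / A`
(`CartierMap.exists_colim_equiv`): an element `φ` of `(F ^ e)^! M` corresponds to the unique `ν` with
`φ(b) = κ ^ e (b ν)`. This yields the description of `ℳ ⊗ ω⁻¹` and of its structural map, both of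
which are transported from `A_f / A`.

*The test modules.* On `k[x]` the operator `𝒞₊` for `x ^ s` sends every nonzero submodule to
`(x ^ ⌊s⌋)`: the inclusion `⊆` is a count of exponents, and for `⊇` one isolates a leading coefficient
by a large power of `κ` (`CartierMap.exists_iter_lineCartier_eq`). A Cartier module with this property
that is torsion-free over its support has `(x ^ ⌊s⌋)` as its test module
(`CartierMap.isLeast_testCandidates`).

*The failure of the axioms.* For `s ≥ 0` the filtration has `V ^ s = A x ^ ⌈s⌉ / f`, which is killed
by `f`. But `f α(x ^ s / f) = x ^ (s p) / f ^ (p - 1)` is nonzero (`not_vFrobeniusStable`). Moreover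
`Gr^0 = k[x, t] / (x, t)` is killed by `x`, whereas its Frobenius pullback along `t = 0` is
`k[x] / (x ^ p)`, which is not (`not_exists_frobenius_pullback_equiv`). The same contrast between
`k` and `k[x] / (x ^ p)` shows that `Gr^1 → F^! Gr^1` is not surjective
(`not_surjective_adjoint_graded`).
-/

noncomputable section

namespace CartierMap

section iterates

/-! ### Iterated adjoints and the colimit `colim_e (F ^ e)^! M` -/

variable {p : ℕ} {A M : Type*} [CommRing A] [AddCommGroup M] [Module A M]

@[simp] theorem iter_zero_apply (κ : CartierMap p A M) (m : M) : κ.iter 0 m = m := rfl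

theorem iter_succ_apply (κ : CartierMap p A M) (e : ℕ) (m : M) :
    κ.iter (e + 1) m = κ (κ.iter e m) := rfl

theorem iter_succ_apply' (κ : CartierMap p A M) (e : ℕ) (m : M) :
    κ.iter (e + 1) m = κ.iter e (κ m) := κ.iter_add e 1 m

/-- The adjoint `M → (F ^ e)^! M`, `m ↦ [r ↦ κ ^ e (r m)]`, of the iterate `κ ^ e`. -/
def iterAdjoint (κ : CartierMap p A M) (e : ℕ) : M →ₗ[A] FShriek p e A A M where
  toFun m := ⟨(κ.iter e).comp (LinearMap.toSpanSingleton A M m).toAddMonoidHom, fun a b => by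
    change κ.iter e ((a ^ p ^ e * b) • m) = a • κ.iter e (b • m)
    rw [mul_smul, iter_pow_smul]⟩
  map_add' m n := by
    ext b
    change κ.iter e (b • (m + n)) = κ.iter e (b • m) + κ.iter e (b • n)
    rw [smul_add, map_add]
  map_smul' a m := by
    ext b
    change κ.iter e (b • (a • m)) = κ.iter e ((a * b) • m)
    rw [smul_smul, mul_comm]

@[simp] theorem iterAdjoint_apply (κ : CartierMap p A M) (e : ℕ) (m : M) (r : A) :
    κ.iterAdjoint e m r = κ.iter e (r • m) := rfl

/-- If `M → F^! M` is bijective, then so is every iterate `M → (F ^ e)^! M`. -/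
theorem iterAdjoint_bijective [Fact p.Prime] [CharP A p] (κ : CartierMap p A M)
    (hκ : Function.Bijective κ.adjoint) (e : ℕ) : Function.Bijective (κ.iterAdjoint e) := by
  induction e with
  | zero =>
    refine ⟨fun m n h => ?_, fun φ => ⟨φ 1, ?_⟩⟩
    · simpa using DFunLike.congr_fun h 1
    · ext b
      have h := FShriek.map_pow_mul φ b 1
      simpa using h.symm
  | succ e ih =>
    have hinj : ∀ m : M, (∀ b : A, κ.iter (e + 1) (b • m) = 0) → m = 0 := by
      intro m hm
      refine hκ.1 ?_
      rw [map_zero]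
      ext b
      refine ih.1 ?_
      ext c
      change κ.iter e (c • κ (b • m)) = κ.iter e (c • (0 : M))
      rw [smul_zero, map_zero, ← κ.map_pow_smul, smul_smul, ← iter_succ_apply', hm]
    constructor
    · intro m n h
      rw [← sub_eq_zero]
      refine hinj _ fun b => ?_
      have h1 : κ.iter (e + 1) (b • m) = κ.iter (e + 1) (b • n) := DFunLike.congr_fun h b
      rw [smul_sub, map_sub, h1, sub_self]
    · intro φ
      -- `c ↦ φ (b c ^ p)` lies in `(F ^ e)^! M`, hence is represented by some `ν b`.
      have key : ∀ b : A, ∃ ν : M, ∀ c : A, κ.iter e (c • ν) = φ (b * c ^ p) := by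
        intro b
        obtain ⟨ν, hν⟩ := ih.2 ⟨(φ.1.comp (AddMonoidHom.mulLeft b)).comp
          (frobenius A p).toAddMonoidHom, fun a c => by
            change φ (b * (a ^ p ^ e * c) ^ p) = a • φ (b * c ^ p)
            have h := FShriek.map_pow_mul φ a (b * c ^ p)
            rw [← h]
            congr 1
            simp only [Algebra.algebraMap_self_apply]
            ring⟩
        exact ⟨ν, fun c => DFunLike.congr_fun hν c⟩
      choose ν hν using key
      have huniq : ∀ m n : M, (∀ c : A, κ.iter e (c • m) = κ.iter e (c • n)) → m = n :=
        fun m n h => ih.1 (FShriek.ext h)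
      obtain ⟨m, hm⟩ := hκ.2 ⟨{ toFun := ν
                                map_zero' := huniq _ _ fun c => by simp [hν]
                                map_add' := fun a b => huniq _ _ fun c => by
                                  rw [smul_add, map_add, hν, hν, hν, add_mul, map_add] },
        fun a b => huniq _ _ fun c => by
          change κ.iter e (c • ν (a ^ p ^ 1 * b)) = κ.iter e (c • a • ν b)
          rw [hν, smul_smul, hν]
          congr 1
          ring⟩
      refine ⟨m, ?_⟩
      ext b
      have h : κ (b • m) = ν b := DFunLike.congr_fun hm b
      rw [iterAdjoint_apply, iter_succ_apply', h]
      simpa using hν b 1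

end iterates

end CartierMap

/-- The map `(F ^ e)^! M → (F ^ e)^! N` induced by a linear map `M → N`. -/
def FShriek.map {p : ℕ} {A M N : Type*} [CommRing A] [AddCommGroup M] [Module A M]
    [AddCommGroup N] [Module A N] (e : ℕ) (ι : M →ₗ[A] N) :
    FShriek p e A A M →ₗ[A] FShriek p e A A N where
  toFun φ := ⟨ι.toAddMonoidHom.comp φ.1, fun a b => by
    change ι (φ _) = a • ι (φ b)
    rw [FShriek.map_pow_mul, map_smul]⟩
  map_add' φ ψ := by
    ext b
    exact map_add ι _ _
  map_smul' a φ := rfl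

namespace CartierMap

section colimit

variable {p : ℕ} {A M N : Type*} [CommRing A] [AddCommGroup M] [Module A M]
  [AddCommGroup N] [Module A N]

theorem iter_map (κ : CartierMap p A M) (κN : CartierMap p A N) (ι : M →ₗ[A] N)
    (hι : ∀ m, ι (κ m) = κN (ι m)) (e : ℕ) (m : M) : ι (κ.iter e m) = κN.iter e (ι m) := by
  induction e with
  | zero => rfl
  | succ e ih => rw [iter_succ_apply, hι, ih, iter_succ_apply]

variable [Fact p.Prime] [CharP A p]

theorem colimAdjoint_apply (κ : CartierMap p A M) (m : κ.Colim) (b : A) :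
    κ.colimAdjoint m b = κ.colim (b • m) := by
  change _ = κ.colimAdjoint (b • m) 1
  rw [map_smul, FShriek.smul_apply, mul_one]
  rfl

theorem colim_toColimOf (κ : CartierMap p A M) (e : ℕ) (φ : FShriek p e A A M) :
    κ.colim (κ.toColimOf e φ) = κ.toColimOf e (κ.shriek e φ) := by
  change κ.colimAdjoint (κ.toColimOf e φ) 1 = _
  have h : κ.colimAdjoint (κ.toColimOf e φ) 1 = κ.toColimOf e (κ.shriek e ((1 : A) • φ)) := by
    unfold colimAdjoint toColimOf
    exact DFunLike.congr_fun (Module.DirectLimit.lift_of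
      (G := fun e : ℕ => FShriek p e A A M) _ _ φ) 1
  rw [h, one_smul]

/-- Let `N` be a Cartier module with `N ≅ F^! N`, and let `ι : M → N` be an injective morphism of
Cartier modules whose cokernel is nilpotent in the sense that every `ν` satisfies
`κ ^ e (A ν) ⊆ M` for some `e`. Then `N` is the colimit `colim_e (F ^ e)^! M`. -/
theorem exists_colim_equiv (κ : CartierMap p A M) (κN : CartierMap p A N)
    (hN : Function.Bijective κN.adjoint) (ι : M →ₗ[A] N) (hinj : Function.Injective ι)
    (hι : ∀ m, ι (κ m) = κN (ι m))
    (hnil : ∀ ν : N, ∃ e : ℕ, ∀ b : A, κN.iter e (b • ν) ∈ LinearMap.range ι) :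
    ∃ ψ : κ.Colim ≃ₗ[A] N, (∀ m, ψ (κ.toColim m) = ι m) ∧
      ∀ m, ψ (κ.colim m) = κN (ψ m) := by
  let E (e : ℕ) : N ≃ₗ[A] FShriek p e A A N :=
    LinearEquiv.ofBijective (κN.iterAdjoint e) (κN.iterAdjoint_bijective hN e)
  let ψ₀ (e : ℕ) : FShriek p e A A M →ₗ[A] N := (E e).symm.toLinearMap.comp (FShriek.map e ι)
  have h₀ : ∀ (e : ℕ) (φ : FShriek p e A A M) (b : A), κN.iter e (b • ψ₀ e φ) = ι (φ b) :=
    fun e φ b => DFunLike.congr_fun ((E e).apply_symm_apply (FShriek.map e ι φ)) b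
  -- `ψ₀ e φ` is characterized by `κ ^ e (b ν) = ι (φ b)` for all `b`.
  have huniq : ∀ (e : ℕ) (φ : FShriek p e A A M) (ν : N),
      (∀ b : A, κN.iter e (b • ν) = ι (φ b)) → ψ₀ e φ = ν := fun e φ ν h =>
    (E e).injective (FShriek.ext fun b => (h₀ e φ b).trans (h b).symm)
  let ψ : κ.Colim →ₗ[A] N := Module.DirectLimit.lift A ℕ (fun e : ℕ => FShriek p e A A M)
    κ.transition ψ₀ fun i j hij φ => huniq _ _ _ fun b => by
      obtain ⟨d, rfl⟩ := Nat.exists_eq_add_of_le hij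
      change _ = ι (κ.iter (i + d - i) (φ b))
      rw [Nat.add_sub_cancel_left, iter_map κ κN ι hι, ← h₀ i φ b, ← iter_add, add_comm d i]
  have hψ : ∀ (e : ℕ) (φ : FShriek p e A A M), ψ (κ.toColimOf e φ) = ψ₀ e φ := fun e φ =>
    Module.DirectLimit.lift_of (G := fun e : ℕ => FShriek p e A A M) _ _ φ
  have hsurj : ∀ m : κ.Colim, ∃ (e : ℕ) (φ : FShriek p e A A M), κ.toColimOf e φ = m :=
    fun m => Module.DirectLimit.exists_of m
  have hbij : Function.Bijective ψ := by
    constructor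
    · rw [injective_iff_map_eq_zero]
      intro m hm
      obtain ⟨e, φ, rfl⟩ := hsurj m
      rw [hψ] at hm
      have : φ = 0 := by
        ext b
        refine hinj ?_
        rw [← h₀ e φ b, hm, smul_zero, map_zero]
        exact (map_zero ι).symm
      rw [this, map_zero]
    · intro ν
      obtain ⟨e, he⟩ := hnil ν
      choose φ hφ using he
      refine ⟨κ.toColimOf e ⟨{ toFun := φ
                               map_zero' := hinj (by rw [hφ]; simp)
                               map_add' := fun a b => hinj (by
                                rw [map_add, hφ, hφ, hφ, add_smul, map_add]) },
        fun a b => hinj ?_⟩, ?_⟩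
      · change ι (φ (a ^ p ^ e * b)) = ι (a • φ b)
        rw [map_smul, hφ, hφ, mul_smul, iter_pow_smul]
      · rw [hψ]
        exact huniq _ _ _ fun b => (hφ b).symm
  refine ⟨LinearEquiv.ofBijective ψ hbij, fun m => ?_, fun m => ?_⟩
  · change ψ (κ.toColimOf 0 (κ.toShriekZero m)) = ι m
    rw [hψ]
    exact huniq _ _ _ fun b => (map_smul ι b m).symm
  · obtain ⟨e, φ, rfl⟩ := hsurj m
    change ψ (κ.colim _) = κN (ψ _)
    rw [colim_toColimOf, hψ, hψ]
    refine huniq _ _ _ fun b => ?_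
    change _ = ι (κ (φ (b ^ p)))
    rw [hι, ← h₀ e φ, ← κN.map_pow_smul, ← iter_succ_apply', ← iter_succ_apply]

/-- Bijectivity of `C : ℳ → F^! ℳ` follows from that of `N → F^! N` if `ℳ ≅ N` as Cartier
modules. -/
theorem colimAdjoint_bijective_of_equiv (κ : CartierMap p A M) (κN : CartierMap p A N)
    (hN : Function.Bijective κN.adjoint) (ψ : κ.Colim ≃ₗ[A] N)
    (hψ : ∀ m, ψ (κ.colim m) = κN (ψ m)) : Function.Bijective κ.colimAdjoint := by
  have h : ∀ (m : κ.Colim) (b : A), ψ (κ.colimAdjoint m b) = κN.adjoint (ψ m) b := fun m b => by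
    rw [colimAdjoint_apply, hψ, map_smul, adjoint_apply]
  constructor
  · intro m n hmn
    refine ψ.injective (hN.1 (FShriek.ext fun b => ?_))
    rw [← h, ← h, hmn]
  · intro φ
    obtain ⟨ν, hν⟩ := hN.2 (FShriek.map 1 ψ.toLinearMap φ)
    refine ⟨ψ.symm ν, FShriek.ext fun b => ψ.injective ?_⟩
    rw [h, ψ.apply_symm_apply, hν]
    rfl

end colimit

section dualBasis

/-! ### Dual bases, Frobenius structures and unit `F`-modules -/

variable {p : ℕ} {A N ι : Type*} [CommRing A] [AddCommGroup N] [Module A N] [Fintype ι]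

/-- `b` and `c` are dual to each other under `κ`: every `a ∈ A` equals `∑ i, κ (c i a) ^ p b i`.
The families generate `F_* A`, and `κ` generates `F^! A`. -/
def IsDualBasis (κ : CartierMap p A A) (b c : ι → A) : Prop :=
  ∀ a : A, ∑ i, κ (c i * a) ^ p * b i = a

variable [Fact p.Prime] [CharP A p]

/-- A module `N` with a Frobenius-linear map `F` and a Cartier structure `κN` such that
`κN (a F ν) = κ(a) ν` and `ν = ∑ b i F (κN (c i ν))`; under `ω_A ≅ A`, the unit `F`-module `(N, F)`
and the Cartier module `(N, κN)` with `N ≅ F^! N` determine each other. -/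
structure IsFrobeniusDual (κ : CartierMap p A A) (b c : ι → A) (κN : CartierMap p A N)
    (F : N →ₛₗ[frobenius A p] N) : Prop where
  map_smul_frobenius : ∀ (a : A) (ν : N), κN (a • F ν) = κ a • ν
  expand : ∀ ν : N, ∑ i, b i • F (κN (c i • ν)) = ν

variable {κ : CartierMap p A A} {b c : ι → A} {κN : CartierMap p A N} {F : N →ₛₗ[frobenius A p] N}

theorem IsFrobeniusDual.eq_zero (h : IsFrobeniusDual κ b c κN F) (ν : N)
    (hν : ∀ a : A, κN (a • ν) = 0) : ν = 0 := by
  rw [← h.expand ν]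
  simp [hν]

/-- The preimage of `φ ∈ F^! N` is `∑ c i F(φ (b i))`. -/
theorem IsFrobeniusDual.adjoint_bijective (h : IsFrobeniusDual κ b c κN F)
    (hb : IsDualBasis κ b c) : Function.Bijective κN.adjoint := by
  constructor
  · rw [injective_iff_map_eq_zero]
    exact fun ν hν => h.eq_zero ν fun a => DFunLike.congr_fun hν a
  · intro φ
    refine ⟨∑ i, c i • F (φ (b i)), FShriek.ext fun a => ?_⟩
    have h1 : ∀ a' b', φ (a' ^ p * b') = a' • φ b' := fun a' b' => by
      have := FShriek.map_pow_mul φ a' b'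
      rwa [pow_one] at this
    conv_rhs => rw [← hb a]
    rw [adjoint_apply, map_sum, Finset.smul_sum, map_sum]
    refine Finset.sum_congr rfl fun i _ => ?_
    rw [smul_smul, h.map_smul_frobenius, h1, mul_comm]

/-- The inverse of the linearization `F^* N → N` is `ν ↦ ∑ b i ⊗ κN (c i ν)`. -/
theorem IsFrobeniusDual.isUnitFModule (h : IsFrobeniusDual κ b c κN F)
    (hb : IsDualBasis κ b c) : IsUnitFModule F := by
  have hsmul : ∀ (r a : A), r • FrobAlg.of p A A a = FrobAlg.of p A A (r ^ p * a) := fun r a => by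
    rw [Algebra.smul_def, map_mul]
    rfl
  let Φ : FrobAlg p A A ⊗[A] N →+ N := TensorProduct.liftAddHom
    { toFun := fun a =>
        { toFun := fun n => (FrobAlg.of p A A).symm a • F n
          map_zero' := by simp
          map_add' := by simp }
      map_zero' := by ext; simp
      map_add' := fun a a' => by ext; simp [add_smul] }
    fun r a n => by
      obtain ⟨a, rfl⟩ := (FrobAlg.of p A A).surjective a
      rw [hsmul]
      change (r ^ p * a) • F n = a • F (r • n)
      rw [map_smulₛₗ, smul_smul, mul_comm]
      rfl
  have hΦ : ∀ (a : A) (n : N), Φ (FrobAlg.of p A A a ⊗ₜ[A] n) = a • F n := fun a n => rfl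
  let Ψ : N →+ FrobAlg p A A ⊗[A] N :=
    { toFun := fun ν => ∑ i, FrobAlg.of p A A (b i) ⊗ₜ[A] κN (c i • ν)
      map_zero' := by simp
      map_add' := fun ν ν' => by simp [TensorProduct.tmul_add, Finset.sum_add_distrib] }
  have hΨΦ : ∀ z, Ψ (Φ z) = z := fun z => by
    induction z with
    | zero => rw [map_zero, map_zero]
    | add z z' hz hz' => rw [map_add, map_add, hz, hz']
    | tmul a n => ?_
    obtain ⟨a, rfl⟩ := (FrobAlg.of p A A).surjective a
    rw [hΦ]
    change ∑ i, FrobAlg.of p A A (b i) ⊗ₜ[A] κN (c i • a • F n) = FrobAlg.of p A A a ⊗ₜ[A] n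
    conv_rhs => rw [← hb a, map_sum, TensorProduct.sum_tmul]
    refine Finset.sum_congr rfl fun i _ => ?_
    rw [smul_smul, h.map_smul_frobenius, ← TensorProduct.smul_tmul, hsmul]
  refine ⟨{ Φ with
            invFun := Ψ
            left_inv := hΨΦ
            right_inv := fun ν => ?_ }, hΦ⟩
  change Φ (∑ i, FrobAlg.of p A A (b i) ⊗ₜ[A] κN (c i • ν)) = ν
  rw [map_sum]
  exact h.expand ν

/-- Unit `F`-modules are stable under transport of the structural map along an isomorphism. -/
theorem _root_.IsUnitFModule.of_equiv {N' : Type*} [AddCommGroup N'] [Module A N']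
    (hF : IsUnitFModule F) (Θ : N' ≃ₗ[A] N) (α : N' →ₛₗ[frobenius A p] N')
    (hα : ∀ n, Θ (α n) = F (Θ n)) : IsUnitFModule α := by
  obtain ⟨Φ, hΦ⟩ := hF
  refine ⟨((TensorProduct.congr (LinearEquiv.refl A (FrobAlg p A A)) Θ).toAddEquiv.trans Φ).trans
    Θ.symm.toAddEquiv, fun a n => Θ.injective ?_⟩
  rw [map_smul, hα, ← hΦ]
  exact Θ.apply_symm_apply _

end dualBasis

end CartierMap

namespace CartierMap

/-! ### Dual bases over a field and over polynomial rings -/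

/-- If `k` is `F`-finite and `κ` generates `F^! k`, then `κ` admits a dual basis: the coordinates
with respect to a basis of `F_* k` are of the form `κ (c i ·)`. -/
theorem exists_isDualBasis {p : ℕ} [Fact p.Prime] {k : Type*} [Field k] [CharP k p]
    (hk : (frobenius k p).Finite) (κ : CartierMap p k k) (hκ : Function.Surjective κ.adjoint) :
    ∃ (n : ℕ) (b c : Fin n → k), κ.IsDualBasis b c := by
  let _ : Algebra k (FrobAlg p k k) := (frobenius k p).toAlgebra
  have _ : Module.Finite k (FrobAlg p k k) := hk
  let B := Module.finBasis k (FrobAlg p k k)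
  have hsmul : ∀ r a : k, r • FrobAlg.of p k k a = FrobAlg.of p k k (r ^ p * a) := fun r a => rfl
  have hc : ∀ i, ∃ c : k, ∀ a : k, κ (c * a) = B.repr (FrobAlg.of p k k a) i := by
    intro i
    obtain ⟨c, hc⟩ := hκ ⟨(B.coord i).toAddMonoidHom.comp (FrobAlg.of p k k).toAddMonoidHom,
      fun a b => by
        change B.repr (FrobAlg.of p k k (a ^ p ^ 1 * b)) i = a * B.repr (FrobAlg.of p k k b) i
        rw [pow_one, ← hsmul, map_smul, Finsupp.smul_apply, smul_eq_mul]⟩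
    refine ⟨c, fun a => ?_⟩
    rw [mul_comm]
    exact DFunLike.congr_fun hc a
  choose c hc using hc
  refine ⟨_, fun i => (FrobAlg.of p k k).symm (B i), c, fun a => ?_⟩
  simp only [hc]
  refine (FrobAlg.of p k k).injective ?_
  conv_rhs => rw [← B.sum_repr (FrobAlg.of p k k a)]
  rw [map_sum]
  refine Finset.sum_congr rfl fun i _ => ?_
  rw [← hsmul, RingEquiv.apply_symm_apply]

section line

variable {p : ℕ} [hp : Fact p.Prime] {B : Type*} [CommRing B] [CharP B p]

theorem coeff_lineCartier (κ : CartierMap p B B) (f : B[X]) (j : ℕ) :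
    (lineCartier κ f).coeff j = κ (f.coeff (p * (j + 1) - 1)) := coeff_lineFun κ f j

theorem coeff_iter_lineCartier (κ : CartierMap p B B) (e : ℕ) (f : B[X]) (j : ℕ) :
    ((lineCartier κ).iter e f).coeff j = κ.iter e (f.coeff (p ^ e * (j + 1) - 1)) := by
  induction e generalizing j with
  | zero => simp
  | succ e ih =>
    have h : 0 < p * (j + 1) := Nat.mul_pos hp.out.pos j.succ_pos
    rw [iter_succ_apply, coeff_lineCartier, ih, iter_succ_apply, Nat.sub_add_cancel h, pow_succ,
      mul_assoc]

/-- The monomial `r X ^ (p q + l)` is sent to `κ(r) X ^ q` for `l = p - 1` and to zero for smaller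
`l`, written in terms of the multiplication by `c X ^ (p - 1 - n)`. -/
theorem lineCartier_mul_monomial (κ : CartierMap p B B) (c r : B) (q : ℕ) (n l : Fin p) :
    lineCartier κ (monomial (p - 1 - n) c * monomial (p * q + l) r) =
      if n = l then monomial q (κ (c * r)) else 0 := by
  rw [monomial_mul_monomial]
  ext j
  rw [coeff_lineCartier, coeff_monomial, apply_ite (fun f : B[X] => f.coeff j), coeff_monomial,
    coeff_zero]
  have hn := n.2
  have hl := l.2
  have h1 : p * (j + 1) = p * j + p := by ring
  by_cases hjq : q = j
  · subst hjq
    have : (p - 1 - n + (p * q + l) = p * (q + 1) - 1) ↔ n = l := by rw [Fin.ext_iff]; omega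
    simp only [this, if_true]
    split_ifs <;> simp
  · rw [if_neg hjq, ite_self, if_neg, map_zero]
    intro h
    rcases Nat.lt_or_gt_of_ne hjq with h2 | h2
    · obtain ⟨d, rfl⟩ := Nat.exists_eq_add_of_lt h2
      have : p * (q + d + 1) = p * q + p * d + p := by ring
      omega
    · obtain ⟨d, rfl⟩ := Nat.exists_eq_add_of_lt h2
      have : p * (j + d + 1) = p * j + p * d + p := by ring
      omega

/-- A dual basis `(b i, c i)` of `B` yields the dual basis `(b i X ^ n, c i X ^ (p - 1 - n))`,
`0 ≤ n < p`, of `B[X]`. -/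
theorem IsDualBasis.line {ι : Type*} [Fintype ι] {κ : CartierMap p B B} {b c : ι → B}
    (h : κ.IsDualBasis b c) :
    (lineCartier κ).IsDualBasis (fun i : ι × Fin p => monomial (i.2 : ℕ) (b i.1))
      (fun i : ι × Fin p => monomial (p - 1 - i.2 : ℕ) (c i.1)) := by
  intro f
  induction f using Polynomial.induction_on' with
  | add f g hf hg =>
    simp only [mul_add, map_add, add_pow_char, add_mul, Finset.sum_add_distrib, hf, hg]
  | monomial m r =>
    have hm : m = p * (m / p) + (⟨m % p, Nat.mod_lt _ hp.out.pos⟩ : Fin p) :=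
      (Nat.div_add_mod m p).symm
    generalize (⟨m % p, Nat.mod_lt _ hp.out.pos⟩ : Fin p) = l at hm
    generalize m / p = q at hm
    subst hm
    rw [Fintype.sum_prod_type]
    simp only [lineCartier_mul_monomial]
    have h1 : ∀ i, ∑ n : Fin p, (if n = l then monomial q (κ (c i * r)) else 0) ^ p *
        monomial (n : ℕ) (b i) = monomial (p * q + l) (κ (c i * r) ^ p * b i) := by
      intro i
      rw [Finset.sum_eq_single l]
      · rw [if_pos rfl, monomial_pow, monomial_mul_monomial, mul_comm q]
      · intro n _ hn
        rw [if_neg hn, zero_pow hp.out.ne_zero, zero_mul]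
      · simp
    simp only [h1]
    rw [← map_sum, h r]

end line

theorem exists_apply_ne_zero {p : ℕ} {k : Type*} [Field k] {κ : CartierMap p k k}
    (hκ : Function.Injective κ.adjoint) : ∃ u, κ u ≠ 0 := by
  by_contra! h
  have h1 : (1 : k) = 0 := hκ (FShriek.ext fun r => by simp [h])
  exact one_ne_zero h1

/-- A nonzero Cartier structure on a field is surjective together with all its iterates, even when
restricted to the multiples of a nonzero element. -/
theorem exists_iter_mul_eq_one {p : ℕ} {k : Type*} [Field k] {κ : CartierMap p k k} {u : k}
    (hu : κ u ≠ 0) {c : k} (hc : c ≠ 0) (e : ℕ) : ∃ r : k, κ.iter e (r * c) = 1 := by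
  have hsurj : Function.Surjective (κ.iter e) := by
    induction e with
    | zero => exact fun a => ⟨a, rfl⟩
    | succ e ih =>
      intro a
      obtain ⟨y, hy⟩ := ih ((a / κ u) ^ p • u)
      exact ⟨y, by rw [iter_succ_apply, hy, map_pow_smul, smul_eq_mul, div_mul_cancel₀ _ hu]⟩
  obtain ⟨y, hy⟩ := hsurj 1
  exact ⟨y / c, by rw [div_mul_cancel₀ _ hc, hy]⟩

end CartierMap

namespace CartierMap

/-! ### Test modules of `ω_R` and of its pushforward -/

section support

variable {p : ℕ} {A M : Type*} [CommRing A] [AddCommGroup M] [Module A M]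

/-- Let `M` be torsion-free over `A ⧸ P` for a prime `P`. If a nonzero submodule `S` contains every
`𝒞₊ N` and is contained in it for `N ≠ 0`, then `S` is the test module: it is the stable value of
the chain `(𝒞₊) ^ h M`, the only generic point of its support is `P`, and agreeing with `S` at `P`
means to be nonzero. -/
theorem isLeast_testCandidates (κ : CartierMap p A M) (f : A) (t : ℚ) (P : Ideal A) [P.IsPrime]
    (hP : ∀ (a : A) (m : M), a • m = 0 ↔ a ∈ P ∨ m = 0) (S : Submodule A M) (hS : S ≠ ⊥)
    (hle : ∀ N, κ.plus f t N ≤ S) (hge : ∀ N, N ≠ ⊥ → S ≤ κ.plus f t N) :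
    IsLeast (κ.testCandidates f t) S := by
  have hplus : ∀ N, N ≠ ⊥ → κ.plus f t N = S := fun N hN => le_antisymm (hle N) (hge N hN)
  have htop : (⊤ : Submodule A M) ≠ ⊥ := fun h => hS (le_bot_iff.1 (h ▸ le_top))
  have hiter : ∀ h : ℕ, (κ.plus f t)^[h + 1] ⊤ = S := by
    intro h
    induction h with
    | zero => exact hplus _ htop
    | succ h ih => rw [Function.iterate_succ_apply', ih, hplus S hS]
  have hstable : κ.stable f t = S := by
    refine le_antisymm ((iInf_le _ 1).trans (hiter 0).le) (le_iInf fun h => ?_)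
    cases h with
    | zero => exact le_top
    | succ h => exact (hiter h).ge
  obtain ⟨m, hm, hm0⟩ := S.ne_bot_iff.1 hS
  have hmin : Minimal (· ∈ Module.support A S) ⟨P, inferInstance⟩ := by
    constructor
    · refine Module.mem_support_iff'.2 ⟨⟨m, hm⟩, fun r hr h => ?_⟩
      rcases (hP r m).1 (congrArg Subtype.val h) with h | h
      exacts [hr h, hm0 h]
    · intro q hq _ a ha
      rw [Module.mem_support_iff'] at hq
      obtain ⟨n, hn⟩ := hq
      by_contra haq
      exact hn a haq (Subtype.ext ((hP a n).2 (Or.inl ha)))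
  constructor
  · exact ⟨hle S, fun η _ => by rw [hstable]⟩
  · rintro N ⟨hN, hη⟩
    refine (hge N ?_).trans hN
    rintro rfl
    rw [hstable] at hη
    have h : Submodule.localized P.primeCompl (⊥ : Submodule A M) = S.localized P.primeCompl :=
      hη _ hmin
    have h1 : LocalizedModule.mkLinearMap P.primeCompl M m ∈ S.localized P.primeCompl :=
      ⟨m, hm, 1, by simp⟩
    rw [← h] at h1
    obtain ⟨z, hz, t, ht⟩ := h1
    rw [(Submodule.mem_bot A).1 hz, IsLocalizedModule.mk'_zero] at ht
    obtain ⟨s, hs⟩ := (IsLocalizedModule.eq_zero_iff P.primeCompl _).1 ht.symm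
    rcases (hP s m).1 hs with h | h
    exacts [s.2 h, hm0 h]

end support

section line

variable {p : ℕ} [hp : Fact p.Prime] {k : Type*} [Field k] [CharP k p]

/-- `κ ^ e` maps `x ^ ⌈s p ^ e⌉ k[x]` into `x ^ ⌊s⌋ k[x]`, since the coefficient of `x ^ d` in the
image comes from that of `x ^ (p ^ e (d + 1) - 1)`, and `p ^ e (d + 1) ≤ s p ^ e` if `d < ⌊s⌋`. -/
theorem X_pow_dvd_iter_lineCartier (κ : CartierMap p k k) {s : ℚ} (hs : 0 ≤ s) (e : ℕ)
    (g : k[X]) : X ^ ⌊s⌋₊ ∣ (lineCartier κ).iter e (X ^ ⌈s * (p : ℚ) ^ e⌉₊ * g) := by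
  rw [X_pow_dvd_iff]
  intro d hd
  rw [coeff_iter_lineCartier, coeff_X_pow_mul', if_neg, map_zero]
  have h1 : (p ^ e * (d + 1) : ℕ) ≤ ⌈s * (p : ℚ) ^ e⌉₊ := by
    have h2 : ((d + 1 : ℕ) : ℚ) ≤ s := (Nat.cast_le.2 hd).trans (Nat.floor_le hs)
    have h3 : ((p ^ e * (d + 1) : ℕ) : ℚ) ≤ ⌈s * (p : ℚ) ^ e⌉₊ := by
      refine le_trans ?_ (Nat.le_ceil _)
      rw [Nat.cast_mul, mul_comm, Nat.cast_pow]
      gcongr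
    exact_mod_cast h3
  have h4 : 0 < p ^ e * (d + 1) := Nat.mul_pos (pow_pos hp.out.pos e) d.succ_pos
  omega

/-- For `g ≠ 0` and `e ≫ 0` some multiple of `x ^ ⌈s p ^ e⌉ g` is sent by `κ ^ e` to `x ^ ⌊s⌋`: for
`n + deg g = p ^ e (⌊s⌋ + 1) - 1`, only the leading coefficient of `x ^ n g` contributes. -/
theorem exists_iter_lineCartier_eq {κ : CartierMap p k k} {u : k} (hu : κ u ≠ 0) {s : ℚ}
    {g : k[X]} (hg : g ≠ 0) : ∃ e : ℕ, 1 ≤ e ∧ ∃ h : k[X],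
      (lineCartier κ).iter e (X ^ ⌈s * (p : ℚ) ^ e⌉₊ * (h * g)) = X ^ ⌊s⌋₊ := by
  set a := ⌊s⌋₊ with ha
  set D := g.natDegree with hD
  have hs1 : 0 < (a : ℚ) + 1 - s := by linarith [Nat.lt_floor_add_one s]
  -- The exponent `e` is so large that `⌈s p ^ e⌉ + deg g < p ^ e (⌊s⌋ + 1)`, and that a window of
  -- length `deg g` meets at most one index congruent to `-1` modulo `p ^ e`.
  obtain ⟨e, he⟩ := pow_unbounded_of_one_lt (max (D + 1 : ℚ) ((D + 2) / ((a : ℚ) + 1 - s)))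
    (show (1 : ℚ) < p by exact_mod_cast hp.out.one_lt)
  have he1 : D + 1 < p ^ e := by exact_mod_cast (le_max_left _ _).trans_lt he
  have he2 : (D + 2 : ℚ) < p ^ e * ((a : ℚ) + 1 - s) :=
    (div_lt_iff₀ hs1).1 ((le_max_right _ _).trans_lt he)
  have he3 : ⌈s * (p : ℚ) ^ e⌉₊ + D + 1 ≤ p ^ e * (a + 1) := by
    have h1 : (⌈s * (p : ℚ) ^ e⌉₊ : ℚ) ≤ p ^ e * (a + 1) - (D + 1) := by
      have h0 : (0 : ℚ) ≤ p ^ e * (a + 1) - (D + 1) := by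
        have h5 : (D + 1 : ℚ) ≤ p ^ e * 1 := by rw [mul_one]; exact_mod_cast he1.le
        have h6 : (p : ℚ) ^ e * 1 ≤ p ^ e * (a + 1) := by gcongr; linarith [a.cast_nonneg (α := ℚ)]
        linarith
      have h7 : ((p ^ e * (a + 1) - (D + 1) : ℕ) : ℚ) = p ^ e * (a + 1) - (D + 1) := by
        rw [Nat.cast_sub]
        · push_cast; ring
        · have h8 : ((D + 1 : ℕ) : ℚ) ≤ (p ^ e * (a + 1) : ℕ) := by push_cast; linarith
          exact_mod_cast h8
      rw [← h7, Nat.cast_le, Nat.ceil_le, h7]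
      linarith
    have h9 : ((⌈s * (p : ℚ) ^ e⌉₊ + D + 1 : ℕ) : ℚ) ≤ (p ^ e * (a + 1) : ℕ) := by
      push_cast; linarith
    exact_mod_cast h9
  obtain ⟨n, hn⟩ := Nat.exists_eq_add_of_le he3
  have he0 : 1 ≤ e := by
    rcases Nat.eq_zero_or_pos e with rfl | h
    · simp at he1
    · exact h
  obtain ⟨r, hr⟩ := exists_iter_mul_eq_one hu (leadingCoeff_ne_zero.2 hg) e
  refine ⟨e, he0, X ^ n * C r, ?_⟩
  have hprod : X ^ ⌈s * (p : ℚ) ^ e⌉₊ * (X ^ n * C r * g) =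
      X ^ (⌈s * (p : ℚ) ^ e⌉₊ + n) * (C r * g) := by ring
  rw [hprod]
  ext j
  rw [coeff_iter_lineCartier, coeff_X_pow_mul', coeff_C_mul, coeff_X_pow]
  by_cases hja : j = a
  · subst hja
    rw [if_pos rfl, if_pos (by omega), hn, show ⌈s * (p : ℚ) ^ e⌉₊ + D + 1 + n - 1 -
      (⌈s * (p : ℚ) ^ e⌉₊ + n) = D by omega]
    exact hr
  · rw [if_neg hja]
    split_ifs with hle
    · rcases Nat.lt_or_gt_of_ne hja with h | h
      · obtain ⟨d, hd⟩ := Nat.exists_eq_add_of_lt h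
        have : p ^ e * (a + 1) = p ^ e * (j + 1) + p ^ e * d + p ^ e := by rw [hd]; ring
        omega
      · obtain ⟨d, rfl⟩ := Nat.exists_eq_add_of_lt h
        have : p ^ e * (a + d + 1 + 1) = p ^ e * (a + 1) + p ^ e * d + p ^ e := by ring
        rw [coeff_eq_zero_of_natDegree_lt (by omega), mul_zero, map_zero]
    · exact map_zero _

variable {A M : Type*} [CommRing A] [AddCommGroup M] [Module A M]

/-- The test modules of a Cartier module that is identified with `(k[x], κ)` by `θ`, the ring `A`
acting through a surjection `π : A → k[x]` with `π f = x`. -/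
theorem isLeast_testCandidates_line {κ : CartierMap p k k} {u : k} (hu : κ u ≠ 0)
    (κM : CartierMap p A M) (f : A) (π : A →+* k[X]) (hπ : Function.Surjective π) (hf : π f = X)
    (θ : M ≃+ k[X]) (hθ : ∀ (a : A) (m : M), θ (a • m) = π a * θ m)
    (hκ : ∀ m, θ (κM m) = lineCartier κ (θ m)) {s : ℚ} (hs : 0 ≤ s) :
    ∃ S : Submodule A M, (∀ m, m ∈ S ↔ X ^ ⌊s⌋₊ ∣ θ m) ∧
      IsLeast (κM.testCandidates f s) S := by
  have hiter : ∀ (e : ℕ) (m : M), θ (κM.iter e m) = (lineCartier κ).iter e (θ m) := by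
    intro e m
    induction e with
    | zero => rfl
    | succ e ih => rw [iter_succ_apply, hκ, ih, iter_succ_apply]
  let S : Submodule A M :=
    { carrier := {m | X ^ ⌊s⌋₊ ∣ θ m}
      zero_mem' := by simp
      add_mem' := fun {m n} hm hn => by
        change _ ∣ θ (m + n)
        rw [map_add]
        exact dvd_add hm hn
      smul_mem' := fun a m hm => by
        change _ ∣ θ (a • m)
        rw [hθ]
        exact Dvd.dvd.mul_left hm _ }
  have hmem : ∀ m, m ∈ S ↔ X ^ ⌊s⌋₊ ∣ θ m := fun m => Iff.rfl
  refine ⟨S, hmem, ?_⟩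
  have : (RingHom.ker π).IsPrime := RingHom.ker_isPrime π
  refine isLeast_testCandidates κM f s (RingHom.ker π) (fun a m => ?_) S ?_ (fun N => ?_)
    fun N hN => ?_
  · rw [← θ.map_eq_zero_iff, hθ, mul_eq_zero, RingHom.mem_ker, θ.map_eq_zero_iff]
  · rw [S.ne_bot_iff]
    refine ⟨θ.symm (X ^ ⌊s⌋₊), by rw [hmem, AddEquiv.apply_symm_apply], fun h => ?_⟩
    rw [θ.symm.map_eq_zero_iff] at h
    exact pow_ne_zero _ X_ne_zero h
  · refine Submodule.span_le.2 ?_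
    rintro _ ⟨e, -, n, -, rfl⟩
    change _ ∈ S
    rw [hmem, hiter, hθ, map_pow, hf]
    exact X_pow_dvd_iter_lineCartier κ hs e _
  · obtain ⟨n, hn, hn0⟩ := N.ne_bot_iff.1 hN
    obtain ⟨e, he, h, hh⟩ := exists_iter_lineCartier_eq hu (s := s) (θ.map_ne_zero_iff.2 hn0)
    obtain ⟨h, rfl⟩ := hπ h
    intro m hm
    obtain ⟨c, hc⟩ := (hmem m).1 hm
    obtain ⟨c, rfl⟩ := hπ c
    have hmc : m = c • κM.iter e (f ^ ⌈s * (p : ℚ) ^ e⌉₊ • (h • n)) := by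
      refine θ.injective ?_
      rw [hθ, hiter, hθ, hθ, map_pow, hf, hh, hc, mul_comm]
    rw [hmc]
    exact Submodule.smul_mem _ _ (Submodule.subset_span ⟨e, he, _, N.smul_mem h hn, rfl⟩)

end line

end CartierMap

section omega

variable {p : ℕ} [hp : Fact p.Prime] {k : Type*} [Field k] [CharP k p]

theorem polynomialEquiv_omegaLine (κ : CartierMap p k k) (m : Ω[k[X]⁄k]) :
    KaehlerDifferential.polynomialEquiv k (omegaLine κ m) =
      lineCartier κ (KaehlerDifferential.polynomialEquiv k m) :=
  LinearEquiv.apply_symm_apply _ _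

variable (k) in
/-- The trivialization `r dx ↦ r` of `i_* ω_R`. -/
def GraphOmega.coord : GraphOmega k ≃ₗ[k[X]] k[X] :=
  (GraphOmega.of k).symm.trans (KaehlerDifferential.polynomialEquiv k)

theorem GraphOmega.coord_of (m : Ω[k[X]⁄k]) :
    GraphOmega.coord k (GraphOmega.of k m) = KaehlerDifferential.polynomialEquiv k m := rfl

theorem GraphOmega.coord_smul (g : k[X][X]) (m : GraphOmega k) :
    GraphOmega.coord k (g • m) = g.eval X * GraphOmega.coord k m := by
  rw [GraphOmega.smul_def, map_smul, smul_eq_mul]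

theorem GraphOmega.coord_graphOmega (κ : CartierMap p k k) (m : GraphOmega k) :
    GraphOmega.coord k (graphOmega κ m) = lineCartier κ (GraphOmega.coord k m) :=
  polynomialEquiv_omegaLine κ _

variable {κ : CartierMap p k k} {u : k} {s : ℚ}

theorem omegaLine_isLeast_testModule (hu : κ u ≠ 0) (hs : 0 ≤ s) :
    IsLeast ((omegaLine κ).testCandidates X s) ((omegaLine κ).testModule X s) ∧
      ∀ m, m ∈ (omegaLine κ).testModule X s ↔
        X ^ ⌊s⌋₊ ∣ KaehlerDifferential.polynomialEquiv k m := by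
  obtain ⟨S, hmem, hS⟩ := CartierMap.isLeast_testCandidates_line hu (omegaLine κ) X
    (RingHom.id k[X]) Function.surjective_id rfl
    (KaehlerDifferential.polynomialEquiv k).toAddEquiv
    (fun a m => map_smul (KaehlerDifferential.polynomialEquiv k) a m)
    (polynomialEquiv_omegaLine κ) hs
  have h : (omegaLine κ).testModule X s = S := hS.isGLB.sInf_eq
  rw [h]
  exact ⟨hS, hmem⟩

theorem graphOmega_isLeast_testModule (hu : κ u ≠ 0) (hs : 0 ≤ s) :
    IsLeast ((graphOmega κ).testCandidates X s) ((graphOmega κ).testModule X s) ∧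
      ∀ m, m ∈ (graphOmega κ).testModule X s ↔ X ^ ⌊s⌋₊ ∣ GraphOmega.coord k m := by
  obtain ⟨S, hmem, hS⟩ := CartierMap.isLeast_testCandidates_line hu (graphOmega κ) X
    (evalRingHom (X : k[X])) (fun r => ⟨C r, eval_C⟩) eval_X
    (GraphOmega.coord k).toAddEquiv GraphOmega.coord_smul (GraphOmega.coord_graphOmega κ) hs
  have h : (graphOmega κ).testModule X s = S := hS.isGLB.sInf_eq
  rw [h]
  exact ⟨hS, hmem⟩

theorem mem_span_C_X_pow_smul_top (n : ℕ) (m : GraphOmega k) :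
    m ∈ Ideal.span {(C X : k[X][X]) ^ n} • (⊤ : Submodule k[X][X] (GraphOmega k)) ↔
      X ^ n ∣ GraphOmega.coord k m := by
  rw [Submodule.ideal_span_singleton_smul, Submodule.mem_smul_pointwise_iff_exists]
  constructor
  · rintro ⟨m, -, rfl⟩
    rw [GraphOmega.coord_smul, eval_pow, eval_C]
    exact dvd_mul_right _ _
  · rintro ⟨c, hc⟩
    refine ⟨(GraphOmega.coord k).symm c, trivial, (GraphOmega.coord k).injective ?_⟩
    rw [GraphOmega.coord_smul, eval_pow, eval_C, LinearEquiv.apply_symm_apply, hc]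

end omega

section awayQuotient

/-! ### The module `A_f / A` -/

variable {A : Type*} [CommRing A] {f : A}

theorem Localization.Away.algebraMap_injective [IsDomain A]
    (hf : f ≠ 0) : Function.Injective (algebraMap A (Localization.Away f)) :=
  IsLocalization.injective _ (powers_le_nonZeroDivisors_of_noZeroDivisors hf)

theorem Localization.Away.charP (p : ℕ) [IsDomain A] [CharP A p] (hf : f ≠ 0) :
    CharP (Localization.Away f) p :=
  charP_of_injective_algebraMap (Localization.Away.algebraMap_injective hf) p

/-- Every element of `A_f` can be written with a denominator `f ^ (p n)`. -/
theorem Localization.Away.exists_pow_mul_eq (p : ℕ) [hp : Fact p.Prime]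
    (z : Localization.Away f) :
    ∃ (n : ℕ), ∀ m, n ≤ m → ∃ h : A, algebraMap A _ f ^ (p * m) * z = algebraMap A _ h := by
  obtain ⟨n, h, hz⟩ := IsLocalization.Away.surj f z
  refine ⟨n, fun m hm => ?_⟩
  obtain ⟨d, hd⟩ := Nat.exists_eq_add_of_le (hm.trans (Nat.le_mul_of_pos_left m hp.out.pos))
  refine ⟨f ^ d * h, ?_⟩
  rw [hd, map_mul, ← hz, map_pow]
  ring

variable (f) in
/-- The module `A_f / A`, which is the local cohomology of `A` along `f`. -/
abbrev AwayQuotient : Type _ :=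
  Localization.Away f ⧸ LinearMap.range (Algebra.linearMap A (Localization.Away f))

variable (f) in
/-- The class in `A_f / A` of an element of `A_f`. -/
abbrev AwayQuotient.mk : Localization.Away f →ₗ[A] AwayQuotient f :=
  (LinearMap.range (Algebra.linearMap A (Localization.Away f))).mkQ

theorem AwayQuotient.mk_surjective : Function.Surjective (AwayQuotient.mk f) :=
  Submodule.mkQ_surjective _

theorem AwayQuotient.mk_eq_zero (z : Localization.Away f) :
    AwayQuotient.mk f z = 0 ↔ ∃ a : A, algebraMap A _ a = z :=
  Submodule.Quotient.mk_eq_zero _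

/-- The class `g / f` in `A_f / A`. -/
def AwayQuotient.frac (f g : A) : AwayQuotient f :=
  AwayQuotient.mk f (algebraMap A _ g * IsLocalization.Away.invSelf f)

theorem AwayQuotient.frac_add (g h : A) : frac f (g + h) = frac f g + frac f h := by
  rw [frac, map_add, add_mul, map_add, frac, frac]

theorem AwayQuotient.smul_frac (g h : A) : g • frac f h = frac f (g * h) := by
  rw [frac, frac, ← map_smul, Algebra.smul_def, map_mul (algebraMap A _) g h, mul_assoc]

/-- The elements of `A_f / A` that are killed by `f` are the classes `g / f`. -/
theorem AwayQuotient.exists_frac_of_smul_eq_zero {ν : AwayQuotient f} (hν : f • ν = 0) :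
    ∃ g : A, frac f g = ν := by
  obtain ⟨z, rfl⟩ := AwayQuotient.mk_surjective ν
  rw [← map_smul, mk_eq_zero] at hν
  obtain ⟨g, hg⟩ := hν
  refine ⟨g, ?_⟩
  rw [frac, hg, Algebra.smul_def, mul_right_comm, IsLocalization.Away.mul_invSelf, one_mul]

theorem AwayQuotient.exists_pow_smul_eq_zero (ν : AwayQuotient f) : ∃ n : ℕ, f ^ n • ν = 0 := by
  obtain ⟨z, rfl⟩ := AwayQuotient.mk_surjective ν
  obtain ⟨n, h, hz⟩ := IsLocalization.Away.surj f z
  refine ⟨n, ?_⟩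
  rw [← map_smul, mk_eq_zero]
  exact ⟨h, by rw [← hz, Algebra.smul_def, map_pow, mul_comm]⟩

theorem AwayQuotient.frac_eq_zero [IsDomain A] (hf : f ≠ 0) (g : A) : frac f g = 0 ↔ f ∣ g := by
  have h1 := IsLocalization.Away.mul_invSelf (S := Localization.Away f) f
  rw [frac, mk_eq_zero]
  constructor
  · rintro ⟨a, ha⟩
    refine ⟨a, Localization.Away.algebraMap_injective hf ?_⟩
    rw [map_mul, ha, mul_left_comm, h1, mul_one]
  · rintro ⟨a, rfl⟩
    refine ⟨a, ?_⟩
    rw [map_mul, mul_right_comm, h1, one_mul]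

end awayQuotient

section localization

/-! ### The Cartier and Frobenius structures on `A_f / A` -/

variable {p : ℕ} [hp : Fact p.Prime] {A : Type*} [CommRing A] [IsDomain A]

/-- A Cartier structure `κ` on a domain `A` extends to `A_f` through
`κ (h / f ^ (p n)) = κ(h) / f ^ n`. -/
theorem CartierMap.exists_localization (κ : CartierMap p A A) {f : A} (hf : f ≠ 0)
    (z : Localization.Away f) : ∃ w : Localization.Away f, ∀ (n : ℕ) (h : A),
      algebraMap A _ f ^ (p * n) * z = algebraMap A _ h → algebraMap A _ f ^ n * w =
        algebraMap A _ (κ h) := by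
  -- Two presentations `z = h / f ^ (p n) = h' / f ^ (p n')` give `f ^ (p n') h = f ^ (p n) h'` in `A`,
  -- to which `κ` applies; so the value computed from one presentation serves all of them.
  have hinj := Localization.Away.algebraMap_injective hf
  have hu : ∀ n : ℕ, IsUnit (algebraMap A (Localization.Away f) f ^ n) := fun n =>
    (IsLocalization.Away.algebraMap_isUnit f).pow n
  obtain ⟨n₀, h₀, hz⟩ := IsLocalization.Away.surj f z
  obtain ⟨w, hw⟩ := (hu n₀).dvd (a := algebraMap A (Localization.Away f)
    (κ (f ^ (n₀ * (p - 1)) * h₀)))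
  refine ⟨w, fun n h hn => (hu n₀).mul_left_cancel ?_⟩
  rw [mul_left_comm, ← hw, ← map_pow, ← map_mul, ← map_pow, ← map_mul]
  congr 1
  rw [← smul_eq_mul (f ^ n), ← smul_eq_mul (f ^ n₀), ← κ.map_pow_smul, ← κ.map_pow_smul]
  congr 1
  refine hinj ?_
  have hp1 : n₀ * p = n₀ * (p - 1) + n₀ := by
    obtain ⟨q, hq⟩ := Nat.exists_eq_add_of_le hp.out.one_le
    rw [hq, Nat.add_sub_cancel_left]
    ring
  simp only [smul_eq_mul, map_mul, map_pow, ← hz, ← hn, ← pow_mul]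
  rw [hp1, pow_add, mul_comm n p]
  ring

/-- The extension to `A_f` of a Cartier structure on a domain `A`. -/
def CartierMap.localizationFun (κ : CartierMap p A A) {f : A} (hf : f ≠ 0)
    (z : Localization.Away f) : Localization.Away f := (κ.exists_localization hf z).choose

variable {κ : CartierMap p A A} {f : A} (hf : f ≠ 0)

theorem CartierMap.localizationFun_spec (z : Localization.Away f) (n : ℕ) (h : A)
    (hz : algebraMap A _ f ^ (p * n) * z = algebraMap A _ h) :
    algebraMap A _ f ^ n * κ.localizationFun hf z = algebraMap A _ (κ h) :=
  (κ.exists_localization hf z).choose_spec n h hz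

theorem CartierMap.localizationFun_algebraMap (h : A) :
    κ.localizationFun hf (algebraMap A _ h) = algebraMap A _ (κ h) := by
  simpa using CartierMap.localizationFun_spec (κ := κ) hf (algebraMap A _ h) 0 h (by simp)

/-- The Cartier structure `κ (h / f ^ (p n)) = κ(h) / f ^ n` on the `A`-module `A_f`. -/
def CartierMap.localization (κ : CartierMap p A A) (hf : f ≠ 0) :
    CartierMap p A (Localization.Away f) where
  toFun := κ.localizationFun hf
  map_zero' := by
    have h := CartierMap.localizationFun_algebraMap (κ := κ) hf 0
    rwa [map_zero, map_zero, map_zero] at h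
  map_add' z z' := by
    obtain ⟨n, hn⟩ := Localization.Away.exists_pow_mul_eq p z
    obtain ⟨n', hn'⟩ := Localization.Away.exists_pow_mul_eq p z'
    obtain ⟨h, hh⟩ := hn (max n n') (le_max_left _ _)
    obtain ⟨h', hh'⟩ := hn' (max n n') (le_max_right _ _)
    refine ((IsLocalization.Away.algebraMap_isUnit f).pow (max n n')).mul_left_cancel ?_
    rw [CartierMap.localizationFun_spec hf (z + z') _ (h + h') (by rw [mul_add, hh, hh', map_add]),
      mul_add, CartierMap.localizationFun_spec hf z _ h hh,
      CartierMap.localizationFun_spec hf z' _ h' hh', map_add, map_add]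
  map_pow_smul' a z := by
    obtain ⟨n, hn⟩ := Localization.Away.exists_pow_mul_eq p z
    obtain ⟨h, hh⟩ := hn n le_rfl
    refine ((IsLocalization.Away.algebraMap_isUnit f).pow n).mul_left_cancel ?_
    change _ * κ.localizationFun hf (a ^ p • z) = _ * (a • κ.localizationFun hf z)
    rw [CartierMap.localizationFun_spec hf _ _ (a ^ p * h) (by
        rw [mul_smul_comm, hh, Algebra.smul_def, map_mul]), mul_smul_comm,
      CartierMap.localizationFun_spec hf z _ h hh, ← smul_eq_mul, κ.map_pow_smul, smul_eq_mul,
      Algebra.smul_def, map_mul]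

theorem CartierMap.localization_spec (z : Localization.Away f) (n : ℕ) (h : A)
    (hz : algebraMap A _ f ^ (p * n) * z = algebraMap A _ h) :
    algebraMap A _ f ^ n * κ.localization hf z = algebraMap A _ (κ h) :=
  CartierMap.localizationFun_spec hf z n h hz

theorem CartierMap.localization_algebraMap (h : A) :
    κ.localization hf (algebraMap A _ h) = algebraMap A _ (κ h) :=
  CartierMap.localizationFun_algebraMap hf h

theorem CartierMap.localization_smul_pow (a : A) (z : Localization.Away f) :
    κ.localization hf (a • z ^ p) = κ a • z := by
  obtain ⟨n, h, hz⟩ := IsLocalization.Away.surj f z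
  refine ((IsLocalization.Away.algebraMap_isUnit f).pow n).mul_left_cancel ?_
  rw [CartierMap.localization_spec hf _ _ (h ^ p * a) (by
    rw [map_mul, map_pow, ← hz, Algebra.smul_def]; ring), ← smul_eq_mul, κ.map_pow_smul,
    smul_eq_mul, map_mul, ← hz, Algebra.smul_def]
  ring

/-- A dual basis of `A` expands the elements of `A_f` as well. -/
theorem CartierMap.IsDualBasis.localization {ι : Type*} [Fintype ι] {b c : ι → A}
    (hb : κ.IsDualBasis b c) (z : Localization.Away f) :
    ∑ i, b i • κ.localization hf (c i • z) ^ p = z := by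
  obtain ⟨n, hn⟩ := Localization.Away.exists_pow_mul_eq p z
  obtain ⟨h, hh⟩ := hn n le_rfl
  refine ((IsLocalization.Away.algebraMap_isUnit f).pow (p * n)).mul_left_cancel ?_
  rw [hh, Finset.mul_sum]
  conv_rhs => rw [← hb h, map_sum]
  refine Finset.sum_congr rfl fun i _ => ?_
  have h1 := CartierMap.localization_spec (κ := κ) hf (c i • z) n (c i * h) (by
    rw [mul_smul_comm, hh, Algebra.smul_def, map_mul])
  rw [map_mul, map_pow, ← h1, Algebra.smul_def, mul_pow, mul_comm p n, pow_mul]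
  ring

/-- The Cartier structure on `A_f / A` induced by that of `A_f`. -/
def AwayQuotient.cartier (κ : CartierMap p A A) (hf : f ≠ 0) : CartierMap p A (AwayQuotient f) where
  toAddMonoidHom := QuotientAddGroup.map _ _ (κ.localization hf).toAddMonoidHom <| by
    rintro _ ⟨a, rfl⟩
    exact ⟨κ a, (CartierMap.localization_algebraMap hf a).symm⟩
  map_pow_smul' a ν := by
    obtain ⟨z, rfl⟩ := AwayQuotient.mk_surjective ν
    exact congrArg (AwayQuotient.mk f) ((κ.localization hf).map_pow_smul a z)

theorem AwayQuotient.cartier_mk (z : Localization.Away f) :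
    AwayQuotient.cartier κ hf (AwayQuotient.mk f z) = AwayQuotient.mk f (κ.localization hf z) := rfl

/-- `κ (g / f) = κ (f ^ (p - 1) g) / f`. -/
theorem AwayQuotient.cartier_frac (g : A) :
    cartier κ hf (frac f g) = frac f (κ (f ^ (p - 1) * g)) := by
  rw [frac, cartier_mk, frac]
  congr 1
  refine (IsLocalization.Away.algebraMap_isUnit f).mul_left_cancel ?_
  have h1 := IsLocalization.Away.mul_invSelf (S := Localization.Away f) f
  have h := CartierMap.localization_spec (κ := κ) hf
    (algebraMap A _ g * IsLocalization.Away.invSelf f) 1 (f ^ (p - 1) * g) (by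
      rw [mul_one, map_mul, map_pow]
      conv_lhs => rw [← Nat.sub_add_cancel hp.out.one_le, pow_succ]
      linear_combination (algebraMap A (Localization.Away f) f ^ (p - 1) *
        algebraMap A (Localization.Away f) g) * h1)
  rw [pow_one] at h
  rw [h, mul_left_comm, h1, mul_one]

variable [CharP A p]

variable (p) in
/-- The map `[z] ↦ [z ^ p]` of `A_f / A`. -/
def AwayQuotient.frob (hf : f ≠ 0) : AwayQuotient f →ₛₗ[frobenius A p] AwayQuotient f :=
  { QuotientAddGroup.map _ _ (AddMonoidHom.mk' (fun z : Localization.Away f => z ^ p)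
      fun z z' => by
        have := Localization.Away.charP p hf
        exact add_pow_char z z' p) (by
      rintro _ ⟨a, rfl⟩
      exact ⟨a ^ p, map_pow (algebraMap A (Localization.Away f)) a p⟩) with
    map_smul' := fun a ν => by
      obtain ⟨z, rfl⟩ := AwayQuotient.mk_surjective ν
      change AwayQuotient.mk f ((a • z) ^ p) = a ^ p • AwayQuotient.mk f (z ^ p)
      rw [_root_.smul_pow, map_smul] }

theorem AwayQuotient.frob_mk (z : Localization.Away f) :
    AwayQuotient.frob p hf (AwayQuotient.mk f z) = AwayQuotient.mk f (z ^ p) := rfl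

/-- The Frobenius of `A_f / A` does not preserve the elements killed by `f` unless
`f ^ (p - 1)` divides the `p`-th power of the numerator. -/
theorem AwayQuotient.pow_dvd_pow_of_smul_frob_frac_eq_zero {g : A}
    (h : f • frob p hf (frac f g) = 0) : f ^ (p - 1) ∣ g ^ p := by
  rw [frac, frob_mk, ← map_smul, mk_eq_zero] at h
  obtain ⟨a, ha⟩ := h
  refine ⟨a, Localization.Away.algebraMap_injective hf ?_⟩
  have h1 := IsLocalization.Away.mul_invSelf (S := Localization.Away f) f
  rw [map_mul, ha, Algebra.smul_def, map_pow, map_pow, ← mul_assoc, ← pow_succ,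
    Nat.sub_add_cancel hp.out.one_le, ← mul_pow, mul_left_comm, h1, mul_one]

/-- A dual basis of `A` makes `A_f / A` a unit `F`-module and a Cartier module `N ≅ F^! N`. -/
theorem AwayQuotient.isFrobeniusDual {ι : Type*} [Fintype ι] {b c : ι → A}
    (hb : κ.IsDualBasis b c) :
    κ.IsFrobeniusDual b c (AwayQuotient.cartier κ hf) (AwayQuotient.frob p hf) where
  map_smul_frobenius a ν := by
    obtain ⟨z, rfl⟩ := AwayQuotient.mk_surjective ν
    rw [frob_mk, ← map_smul, cartier_mk, CartierMap.localization_smul_pow, map_smul]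
  expand ν := by
    obtain ⟨z, rfl⟩ := AwayQuotient.mk_surjective ν
    conv_rhs => rw [← hb.localization hf z, map_sum]
    refine Finset.sum_congr rfl fun i _ => ?_
    rw [← map_smul (mk f), cartier_mk, frob_mk, map_smul (mk f)]

end localization

section graph

/-! ### The unit `F`-module of the graph embedding -/

variable {p : ℕ} [hp : Fact p.Prime] {k : Type*} [Field k] [CharP k p]

theorem xSubT_ne_zero : xSubT k ≠ 0 := by
  rw [xSubT, ← neg_sub, neg_ne_zero]
  exact X_sub_C_ne_zero X

theorem xSubT_dvd_iff (g : k[X][X]) : xSubT k ∣ g ↔ g.eval X = 0 := by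
  have hneg : xSubT k = -(X - C X) := (neg_sub _ _).symm
  rw [hneg]
  exact neg_dvd.trans dvd_iff_isRoot

theorem IPlus.frac_eq_frac_iff (g h : k[X][X]) :
    IPlus.frac g = IPlus.frac h ↔ g.eval X = h.eval X := by
  rw [← sub_eq_zero, ← sub_eq_zero (b := h.eval X), ← eval_sub, ← xSubT_dvd_iff,
    ← AwayQuotient.frac_eq_zero xSubT_ne_zero (g - h), ← sub_add_cancel g h]
  change AwayQuotient.frac (xSubT k) (g - h + h) - AwayQuotient.frac (xSubT k) h = 0 ↔ _
  rw [AwayQuotient.frac_add, add_sub_cancel_right, sub_add_cancel]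

theorem IPlus.smul_frac (g h : k[X][X]) : g • IPlus.frac h = IPlus.frac (g * h) :=
  AwayQuotient.smul_frac g h

theorem IPlus.frac_eq_zero (g : k[X][X]) : IPlus.frac g = 0 ↔ g.eval X = 0 :=
  (AwayQuotient.frac_eq_zero xSubT_ne_zero g).trans (xSubT_dvd_iff g)

/-- `x ^ n / (x - t)` generates the submodule of all `g / (x - t)` with `x ^ n ∣ g(x, x)`. -/
theorem IPlus.mem_span_frac (n : ℕ) (ν : IPlus k) :
    ν ∈ Submodule.span k[X][X] {IPlus.frac ((C X : k[X][X]) ^ n)} ↔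
      ∃ r : k[X], X ^ n ∣ r ∧ IPlus.frac (C r) = ν := by
  rw [Submodule.mem_span_singleton]
  constructor
  · rintro ⟨g, rfl⟩
    refine ⟨X ^ n * g.eval X, dvd_mul_right _ _, ?_⟩
    rw [IPlus.smul_frac, IPlus.frac_eq_frac_iff]
    simp [mul_comm]
  · rintro ⟨_, ⟨r, rfl⟩, rfl⟩
    refine ⟨C r, ?_⟩
    rw [IPlus.smul_frac, IPlus.frac_eq_frac_iff]
    simp [mul_comm]

/-- The map `κ (x - t) ^ (p - 1)` restricts to the Cartier structure of `k[x]`: only the leading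
coefficient `(-1) ^ (p - 1) = 1` of `(x - t) ^ (p - 1)` contributes. -/
theorem lineCartier_xSubT_pow_mul_C (κ : CartierMap p k[X] k[X]) (r : k[X]) :
    lineCartier κ (xSubT k ^ (p - 1) * C r) = C (κ r) := by
  have hsign : ((-1 : k[X][X]) ^ (p - 1)) = 1 := by
    have h := neg_one_pow_expChar k[X][X] p
    rw [← Nat.sub_add_cancel hp.out.one_le, pow_succ] at h
    simpa using h
  have hmonic : (((X : k[X][X]) - C X) ^ (p - 1)).Monic := (monic_X_sub_C X).pow _
  have hdeg : (((X : k[X][X]) - C X) ^ (p - 1)).natDegree = p - 1 := by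
    rw [natDegree_pow, natDegree_X_sub_C, mul_one]
  have hpow : xSubT k ^ (p - 1) = ((X : k[X][X]) - C X) ^ (p - 1) := by
    have hneg : xSubT k = -(X - C X) := (neg_sub _ _).symm
    have h := neg_pow ((X : k[X][X]) - C X) (p - 1)
    rw [hneg, ← one_mul (((X : k[X][X]) - C X) ^ (p - 1)), ← hsign]
    exact h
  have h2 := hp.out.two_le
  ext1 j
  rw [CartierMap.coeff_lineCartier, coeff_mul_C, hpow, coeff_C]
  rcases Nat.eq_zero_or_pos j with rfl | hj
  · have hcoeff : (((X : k[X][X]) - C X) ^ (p - 1)).coeff (p - 1) = 1 := by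
      conv_lhs => rw [← hdeg]
      simpa only [hdeg] using hmonic.coeff_natDegree
    rw [zero_add, mul_one, if_pos rfl, hcoeff, one_mul]
  · rw [if_neg hj.ne', coeff_eq_zero_of_natDegree_lt, zero_mul, map_zero]
    rw [hdeg]
    have : p * 2 ≤ p * (j + 1) := Nat.mul_le_mul_left _ (by omega)
    omega

variable (k) in
/-- The map `i_* ω_R → i_+ R`, `r dx ↦ r / (x - t)`. -/
def graphOmegaToIPlus : GraphOmega k →ₗ[k[X][X]] IPlus k where
  toFun m := IPlus.frac (C (GraphOmega.coord k m))
  map_add' m n := by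
    rw [map_add, map_add]
    exact AwayQuotient.frac_add _ _
  map_smul' g m := by
    rw [RingHom.id_apply, IPlus.smul_frac, IPlus.frac_eq_frac_iff, GraphOmega.coord_smul]
    simp

theorem graphOmegaToIPlus_injective : Function.Injective (graphOmegaToIPlus k) := by
  intro m n h
  have h1 := (IPlus.frac_eq_frac_iff _ _).1 h
  rw [eval_C, eval_C] at h1
  exact (GraphOmega.coord k).injective h1

variable (k) in
/-- The isomorphism `Hom(ω_{R[t]}, L) ≅ L`, evaluation at the generator `dt ⊗ dx`, followed by
`ψ : L ≅ i_+ R`. -/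
def evalGenEquiv {L : Type*} [AddCommGroup L] [Module k[X][X] L] (ψ : L ≃ₗ[k[X][X]] IPlus k) :
    (OmegaPlane k →ₗ[k[X][X]] L) ≃ₗ[k[X][X]] IPlus k :=
  (LinearEquiv.arrowCongr (omegaPlaneEquiv k) ψ).trans
    (LinearMap.ringLmapEquivSelf k[X][X] k[X][X] (IPlus k))

theorem omegaPlaneEquiv_symm (g : k[X][X]) :
    (omegaPlaneEquiv k).symm g = g • omegaPlaneGen k := by
  rw [LinearEquiv.symm_apply_eq, map_smul, omegaPlaneEquiv_gen, smul_eq_mul, mul_one]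

theorem evalGenEquiv_apply {L : Type*} [AddCommGroup L] [Module k[X][X] L]
    (ψ : L ≃ₗ[k[X][X]] IPlus k) (n : OmegaPlane k →ₗ[k[X][X]] L) :
    evalGenEquiv k ψ n = ψ (n (omegaPlaneGen k)) := by
  change ψ (n ((omegaPlaneEquiv k).symm 1)) = _
  rw [omegaPlaneEquiv_symm, one_smul]

theorem omegaPlane_smul_gen (κ : CartierMap p k k) (g : k[X][X]) :
    omegaPlane κ (g • omegaPlaneGen k) = lineCartier (lineCartier κ) g • omegaPlaneGen k := by
  rw [← omegaPlaneEquiv_symm, ← omegaPlaneEquiv_symm]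
  change (omegaPlaneEquiv k).symm _ = _
  rw [LinearEquiv.apply_symm_apply]

theorem exists_smul_omegaPlaneGen (w : OmegaPlane k) : ∃ g : k[X][X], w = g • omegaPlaneGen k :=
  ⟨omegaPlaneEquiv k w, by rw [← omegaPlaneEquiv_symm, LinearEquiv.symm_apply_apply]⟩

/-- The Cartier structure on `i_+ R`. -/
abbrev IPlus.cartier (κ : CartierMap p k k) : CartierMap p k[X][X] (IPlus k) :=
  AwayQuotient.cartier (lineCartier (lineCartier κ)) xSubT_ne_zero

variable (p k) in
/-- The map `[z] ↦ [z ^ p]` of `i_+ R`. -/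
abbrev IPlus.frob : IPlus k →ₛₗ[frobenius k[X][X] p] IPlus k :=
  AwayQuotient.frob p xSubT_ne_zero

/-- `colim_e (F ^ e)^! i_* ω_R` is `i_+ R` as a Cartier module. -/
theorem exists_colim_graphOmega_equiv (κ : CartierMap p k k)
    (hN : Function.Bijective (IPlus.cartier κ).adjoint) :
    ∃ ψ : (graphOmega κ).Colim ≃ₗ[k[X][X]] IPlus k,
      (∀ m, ψ ((graphOmega κ).toColim m) = IPlus.frac (C (GraphOmega.coord k m))) ∧
      ∀ m, ψ ((graphOmega κ).colim m) = IPlus.cartier κ (ψ m) := by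
  refine (graphOmega κ).exists_colim_equiv (IPlus.cartier κ) hN (graphOmegaToIPlus k)
    graphOmegaToIPlus_injective (fun m => ?_) fun ν => ?_
  · change IPlus.frac (C (GraphOmega.coord k (graphOmega κ m))) =
      AwayQuotient.cartier _ _ (AwayQuotient.frac (xSubT k) (C (GraphOmega.coord k m)))
    rw [AwayQuotient.cartier_frac, lineCartier_xSubT_pow_mul_C, GraphOmega.coord_graphOmega]
    rfl
  · obtain ⟨n, hn⟩ := AwayQuotient.exists_pow_smul_eq_zero ν
    refine ⟨n, fun b => ?_⟩
    -- `κ ^ n (b ν)` is killed by `x - t`, as `(x - t) ^ (p ^ n)` kills `ν`.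
    have h : xSubT k • (IPlus.cartier κ).iter n (b • ν) = 0 := by
      obtain ⟨d, hd⟩ := Nat.exists_eq_add_of_le (Nat.lt_pow_self hp.out.one_lt (n := n)).le
      rw [← CartierMap.iter_pow_smul, hd, pow_add, smul_smul, mul_comm, mul_comm (_ ^ n),
        ← mul_assoc, ← smul_smul, hn, smul_zero, map_zero]
    obtain ⟨g, hg⟩ := AwayQuotient.exists_frac_of_smul_eq_zero h
    refine ⟨(GraphOmega.coord k).symm (g.eval X), Eq.trans ?_ hg⟩
    change IPlus.frac (C (GraphOmega.coord k _)) = IPlus.frac g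
    rw [LinearEquiv.apply_symm_apply, IPlus.frac_eq_frac_iff, eval_C]

/-- The Frobenius-linear map of `ℳ ⊗ ω⁻¹` that corresponds to `[z] ↦ [z ^ p]`. -/
def graphFrob {κ : CartierMap p k k} (Θ : GraphUnit κ ≃ₗ[k[X][X]] IPlus k) :
    GraphUnit κ →ₛₗ[frobenius k[X][X] p] GraphUnit κ :=
  Θ.symm.toLinearMap.comp ((IPlus.frob p k).comp Θ.toLinearMap)

theorem apply_graphFrob {κ : CartierMap p k k} (Θ : GraphUnit κ ≃ₗ[k[X][X]] IPlus k)
    (n : GraphUnit κ) : Θ (graphFrob Θ n) = IPlus.frob p k (Θ n) := Θ.apply_symm_apply _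

/-- The relation `κ(n'(w)) = n(κ w)` reads `κ(g z') = κ(g) z` in `i_+ R`, whose only solution `z'` is
the Frobenius of `z`. -/
theorem isAdjointStructuralMap_graphFrob {κ : CartierMap p k k} {ι : Type*} [Fintype ι]
    {b c : ι → k[X][X]} (hdual : (lineCartier (lineCartier κ)).IsFrobeniusDual b c
      (IPlus.cartier κ) (IPlus.frob p k))
    (ψ : (graphOmega κ).Colim ≃ₗ[k[X][X]] IPlus k)
    (hψ : ∀ m, ψ ((graphOmega κ).colim m) = IPlus.cartier κ (ψ m)) :
    IsAdjointStructuralMap (omegaPlane κ) (graphOmega κ).colim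
      (graphFrob (evalGenEquiv k ψ)) := by
  set Θ := evalGenEquiv k ψ with hΘ
  intro n n'
  have h1 : ∀ g : k[X][X], ψ ((graphOmega κ).colim (n' (g • omegaPlaneGen k))) =
      IPlus.cartier κ (g • Θ n') := fun g => by
    rw [hψ, map_smul, map_smul, hΘ, evalGenEquiv_apply]
  have h2 : ∀ g : k[X][X], ψ (n (omegaPlane κ (g • omegaPlaneGen k))) =
      IPlus.cartier κ (g • IPlus.frob p k (Θ n)) := fun g => by
    rw [hdual.map_smul_frobenius, omegaPlane_smul_gen, map_smul, map_smul, hΘ,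
      evalGenEquiv_apply]
  rw [← Θ.injective.eq_iff, apply_graphFrob]
  constructor
  · intro h w
    obtain ⟨g, rfl⟩ := exists_smul_omegaPlaneGen w
    exact ψ.injective (by rw [h1, h2, h])
  · intro h
    rw [← sub_eq_zero]
    refine hdual.eq_zero _ fun g => ?_
    rw [smul_sub, map_sub, ← h1, ← h2, h, sub_self]

/-- `τ(ℳ, t ^ s) ⊗ ω⁻¹` corresponds to the submodule generated by `x ^ ⌊s⌋ / (x - t)`. -/
theorem mem_graphTest_iff {κ : CartierMap p k k} {u : k} (hu : κ u ≠ 0)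
    (ψ : (graphOmega κ).Colim ≃ₗ[k[X][X]] IPlus k)
    (hψ : ∀ m, ψ ((graphOmega κ).toColim m) = IPlus.frac (C (GraphOmega.coord k m)))
    {s : ℚ} (hs : 0 ≤ s) (n : GraphUnit κ) :
    n ∈ graphTest κ s ↔ evalGenEquiv k ψ n ∈
      Submodule.span k[X][X] {IPlus.frac ((C X : k[X][X]) ^ ⌊s⌋₊)} := by
  have hgen : n ∈ graphTest κ s ↔
      n (omegaPlaneGen k) ∈ (graphOmega κ).colimTestModule X s := by
    refine ⟨fun h => h _, fun h w => ?_⟩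
    obtain ⟨g, rfl⟩ := exists_smul_omegaPlaneGen w
    rw [map_smul]
    exact Submodule.smul_mem _ _ h
  rw [hgen, IPlus.mem_span_frac, evalGenEquiv_apply]
  constructor
  · rintro ⟨m, hm, h⟩
    exact ⟨_, ((graphOmega_isLeast_testModule hu hs).2 m).1 hm, by rw [← h, hψ]⟩
  · rintro ⟨r, hr, h⟩
    refine ⟨(GraphOmega.coord k).symm r, ((graphOmega_isLeast_testModule hu hs).2 _).2 ?_,
      ψ.injective ?_⟩
    · rwa [LinearEquiv.apply_symm_apply]
    · rw [hψ, LinearEquiv.apply_symm_apply, h]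

/-- The shift by `1 - ε` turns the round-down of the test modules into a round-up: `⌊s + 1 - ε⌋` is
`⌈s⌉` for small `ε > 0`, also for `-1 < s ≤ 0`, where both sides vanish. -/
theorem eventually_floor_add_one_sub (s : ℚ) (hs : -1 < s) :
    ∀ᶠ ε : ℚ in nhdsWithin 0 (Set.Ioi 0), 0 ≤ s + 1 - ε ∧ ⌊s + 1 - ε⌋₊ = ⌈s⌉₊ := by
  have h1 : 0 < s + 1 - ⌈s⌉₊ := by
    rcases le_or_gt s 0 with h | h
    · rw [Nat.ceil_eq_zero.2 h, Nat.cast_zero]; linarith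
    · linarith [Nat.ceil_lt_add_one h.le]
  filter_upwards [Ioo_mem_nhdsGT h1] with ε hε
  have h2 := hε.1
  have h3 := hε.2
  have h4 : (0 : ℚ) ≤ ⌈s⌉₊ := Nat.cast_nonneg _
  have h5 : 0 ≤ s + 1 - ε := by linarith
  refine ⟨h5, (Nat.floor_eq_iff h5).2 ⟨by linarith, ?_⟩⟩
  linarith [Nat.le_ceil s]

end graph

section filtration

/-! ### The shifted test module filtration is not a `V`-filtration -/

variable {p : ℕ} [hp : Fact p.Prime] {k : Type*} [Field k] [CharP k p]

/-- `F_{k[x]}^* k` is not killed by `x`: on the tensor product, there is an additive map that sends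
`[a] ⊗ g` to the coefficient of `x` in `a(x, 0)` times `γ(g) ^ p`. It is well defined because a
`p`-th power has no term of degree one. -/
theorem exists_tensor_pairing {G : Type*} [AddCommGroup G] [Module k[X][X] G] (γ : G →+ k)
    (hγ : ∀ (a : k[X][X]) (g : G), γ (a • g) = (a.eval X).coeff 0 * γ g) :
    ∃ β : FrobAlg p k[X][X] (k[X][X] ⧸ Ideal.span {(X : k[X][X])}) ⊗[k[X][X]] G →+ k,
      ∀ (a : k[X][X]) (g : G),
        β (FrobAlg.of p k[X][X] _ (Ideal.Quotient.mk (Ideal.span {X}) a) ⊗ₜ[k[X][X]] g) =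
          (a.eval 0).coeff 1 * γ g ^ p := by
  let π : k[X][X] ⧸ Ideal.span {(X : k[X][X])} →+* k[X] :=
    Ideal.Quotient.lift _ (evalRingHom (0 : k[X])) fun a ha => by
      obtain ⟨b, rfl⟩ := Ideal.mem_span_singleton.1 ha
      simp
  have hπ : ∀ a, π (Ideal.Quotient.mk _ a) = a.eval 0 := fun a => Ideal.Quotient.lift_mk _ _ _
  let β₀ : FrobAlg p k[X][X] (k[X][X] ⧸ Ideal.span {(X : k[X][X])}) →+ G →+ k :=
    { toFun := fun b =>
        { toFun := fun g => (π ((FrobAlg.of p k[X][X] _).symm b)).coeff 1 * γ g ^ p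
          map_zero' := by simp [hp.out.ne_zero]
          map_add' := fun g h => by rw [map_add, add_pow_char, mul_add] }
      map_zero' := by ext; simp
      map_add' := fun b b' => by ext; simp [add_mul] }
  refine ⟨TensorProduct.liftAddHom β₀ fun r b g => ?_, fun a g => ?_⟩
  · obtain ⟨b, rfl⟩ := (FrobAlg.of p k[X][X] _).surjective b
    obtain ⟨a, rfl⟩ := Ideal.Quotient.mk_surjective b
    have h1 : r • FrobAlg.of p k[X][X] _ (Ideal.Quotient.mk (Ideal.span {X}) a) =
        FrobAlg.of p k[X][X] _ (Ideal.Quotient.mk (Ideal.span {X}) (r ^ p * a)) := by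
      rw [Algebra.smul_def, map_mul, map_mul]
      rfl
    have h2 : ((r.eval 0) ^ p).coeff 1 = 0 := by
      have h := coeff_derivative ((r.eval 0) ^ p) 0
      rw [derivative_pow, CharP.cast_eq_zero] at h
      simpa using h.symm
    have h3 : (r.eval X).coeff 0 = (r.eval 0).coeff 0 := by
      have h := sub_dvd_eval_sub (X : k[X]) 0 r
      rw [sub_zero, X_dvd_iff, coeff_sub, sub_eq_zero] at h
      exact h
    rw [h1]
    change (π (Ideal.Quotient.mk _ (r ^ p * a))).coeff 1 * γ g ^ p =
      (π (Ideal.Quotient.mk _ a)).coeff 1 * γ (r • g) ^ p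
    rw [hπ, hπ, hγ, eval_mul, eval_pow, mul_coeff_one, h2, h3, zero_mul, add_zero,
      coeff_zero_eq_eval_zero, eval_pow, ← coeff_zero_eq_eval_zero, mul_pow]
    ring
  · change (π (Ideal.Quotient.mk _ a)).coeff 1 * γ g ^ p = _
    rw [hπ]

variable {N : Type*} [AddCommGroup N] [Module k[X][X] N] (Θ : N ≃ₗ[k[X][X]] IPlus k)
  (V : ℚ → Submodule k[X][X] N)
  (hV : ∀ s : ℚ, 0 ≤ s → ∀ n, n ∈ V s ↔
    Θ n ∈ Submodule.span k[X][X] {IPlus.frac ((C X : k[X][X]) ^ ⌈s⌉₊)})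

include hV

/-- Axiom (iii) fails because `V ^ (s p)` is killed by `x - t`, whereas `(x - t) α(x ^ s / (x - t))`
equals `x ^ (s p) / (x - t) ^ (p - 1)`. -/
theorem not_vFrobeniusStable (α : N →ₛₗ[frobenius k[X][X] p] N)
    (hα : ∀ n, Θ (α n) = IPlus.frob p k (Θ n)) (s : ℕ) : ¬ VFrobeniusStable α V s := by
  intro h
  have hmem : Θ.symm (IPlus.frac ((C X : k[X][X]) ^ s)) ∈ V s := by
    rw [hV _ s.cast_nonneg, LinearEquiv.apply_symm_apply, Nat.ceil_natCast]
    exact Submodule.mem_span_singleton_self _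
  have h1 := h _ hmem
  rw [hV _ (by positivity), hα, LinearEquiv.apply_symm_apply, IPlus.mem_span_frac] at h1
  obtain ⟨r, -, hr⟩ := h1
  have h2 : xSubT k • IPlus.frob p k (IPlus.frac ((C X : k[X][X]) ^ s)) = 0 := by
    rw [← hr, IPlus.smul_frac, IPlus.frac_eq_zero]
    simp
  obtain ⟨a, h4⟩ := AwayQuotient.pow_dvd_pow_of_smul_frob_frac_eq_zero xSubT_ne_zero h2
  have h5 := congrArg (fun g : k[X][X] => g.eval X) h4
  have h6 : p - 1 ≠ 0 := Nat.sub_ne_zero_of_lt hp.out.one_lt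
  simp only [eval_mul, eval_pow, eval_sub, eval_C, eval_X, sub_self, zero_pow h6, zero_mul] at h5
  exact pow_ne_zero _ (pow_ne_zero _ X_ne_zero) h5

/-- `Gr^0` is `k[x, t] ⧸ (x, t)`, generated by the class of `1 / (x - t)`. -/
theorem exists_vGr_zero_generator :
    ∃ (g₀ : VGr V 0) (γ : VGr V 0 →+ k), γ g₀ = 1 ∧ (∀ g : VGr V 0, (C X : k[X][X]) • g = 0) ∧
      ∀ (a : k[X][X]) (g : VGr V 0), γ (a • g) = (a.eval X).coeff 0 * γ g := by
  have h0 : Θ.symm (IPlus.frac 1) ∈ V 0 := by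
    rw [hV _ le_rfl, LinearEquiv.apply_symm_apply, Nat.ceil_zero, pow_zero]
    exact Submodule.mem_span_singleton_self _
  have hΘ : ∀ a : k[X][X], Θ (a • Θ.symm (IPlus.frac 1)) = IPlus.frac a := fun a => by
    rw [map_smul, LinearEquiv.apply_symm_apply, IPlus.smul_frac, mul_one]
  let g₀ : VGr V 0 := VGr.mk V 0 ⟨_, h0⟩
  have hsurj : ∀ g : VGr V 0, ∃ a : k[X][X], a • g₀ = g := by
    intro g
    obtain ⟨⟨n, hn⟩, rfl⟩ := Submodule.mkQ_surjective _ g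
    obtain ⟨a, ha⟩ := Submodule.mem_span_singleton.1 ((hV _ le_rfl n).1 hn)
    refine ⟨a, ?_⟩
    rw [← map_smul]
    congr 1
    refine Subtype.ext (Θ.injective ?_)
    rw [← ha, Nat.ceil_zero, pow_zero, IPlus.smul_frac, mul_one]
    exact hΘ a
  have hzero : ∀ a : k[X][X], a • g₀ = 0 ↔ a • Θ.symm (IPlus.frac 1) ∈ vAbove V 0 := fun a => by
    rw [← map_smul]
    exact Submodule.Quotient.mk_eq_zero _
  have habove : ∀ n ∈ vAbove V 0, ∃ r : k[X], X ∣ r ∧ IPlus.frac (C r) = Θ n := by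
    have hle : vAbove V 0 ≤ (Submodule.span k[X][X]
        {IPlus.frac ((C X : k[X][X]) ^ 1)}).comap Θ.toLinearMap := by
      refine iSup₂_le fun j hj n hn => ?_
      obtain ⟨r, hr, h⟩ := (IPlus.mem_span_frac _ _).1 ((hV j hj.le n).1 hn)
      exact (IPlus.mem_span_frac _ _).2 ⟨r, (pow_dvd_pow X (Nat.ceil_pos.2 hj)).trans hr, h⟩
    intro n hn
    have h := (IPlus.mem_span_frac _ _).1 (hle hn)
    rwa [pow_one] at h
  have hcoeff : ∀ a : k[X][X], a • g₀ = 0 → (a.eval X).coeff 0 = 0 := by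
    intro a ha
    obtain ⟨r, hr, h⟩ := habove _ ((hzero a).1 ha)
    rw [hΘ, IPlus.frac_eq_frac_iff, eval_C] at h
    rw [← h, ← X_dvd_iff]
    exact hr
  have hX : (C X : k[X][X]) • g₀ = 0 := by
    refine (hzero _).2 (le_iSup₂ (f := fun (j : ℚ) (_ : 0 < j) => V j) 1 one_pos ?_)
    rw [hV _ zero_le_one, hΘ, Nat.ceil_one, pow_one]
    exact Submodule.mem_span_singleton_self _
  choose c hc using hsurj
  have hceq : ∀ (a : k[X][X]) (g : VGr V 0), a • g₀ = g →
      ((c g).eval X).coeff 0 = (a.eval X).coeff 0 := by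
    intro a g h
    rw [← sub_eq_zero, ← coeff_sub, ← eval_sub]
    exact hcoeff _ (by rw [sub_smul, hc, h, sub_self])
  refine ⟨g₀, { toFun := fun g => ((c g).eval X).coeff 0
                map_zero' := by
                  rw [hceq 0 0 (zero_smul _ _)]
                  simp
                map_add' := fun g h => by
                  rw [hceq (c g + c h) _ (by rw [add_smul, hc, hc])]
                  simp }, ?_, fun g => ?_, fun a g => ?_⟩
  · change ((c g₀).eval X).coeff 0 = 1
    rw [hceq 1 _ (one_smul _ _)]
    simp
  · rw [← hc g, smul_smul, mul_comm, ← smul_smul, hX, smul_zero]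
  · change ((c (a • g)).eval X).coeff 0 = _ * ((c g).eval X).coeff 0
    rw [hceq (a * c g) _ (by rw [mul_smul, hc]), eval_mul, mul_coeff_zero]

theorem nontrivial_vGr_zero : Nontrivial (VGr V 0) := by
  obtain ⟨g₀, γ, h1, -, -⟩ := exists_vGr_zero_generator Θ V hV
  refine ⟨g₀, 0, fun h => ?_⟩
  rw [h, map_zero] at h1
  exact zero_ne_one h1

/-- Axiom (iv) at `0` comprises axiom (iii) at `0`, because `Gr^0` does not vanish. -/
theorem not_vFrobeniusGraded (α : N →ₛₗ[frobenius k[X][X] p] N)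
    (hα : ∀ n, Θ (α n) = IPlus.frob p k (Θ n)) :
    ¬ VFrobeniusGraded α (Ideal.span {X}) V 0 := by
  intro h
  obtain ⟨h1, -⟩ := h (nontrivial_vGr_zero Θ V hV)
  refine not_vFrobeniusStable Θ V hV α hα 0 fun m hm => ?_
  rw [Nat.cast_zero] at hm ⊢
  exact h1 ⟨m, hm⟩

/-- `x` kills `Gr^0`, but not `F_{k[x]}^* Gr^0 = k[x] ⧸ (x ^ p)`. -/
theorem not_exists_frobenius_pullback_equiv :
    ¬ ∃ Φ : FrobAlg p k[X][X] (k[X][X] ⧸ Ideal.span {(X : k[X][X])}) ⊗[k[X][X]] VGr V 0 ≃+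
        VGr V 0, ∀ (a : k[X][X]) (z : FrobAlg p k[X][X] (k[X][X] ⧸ Ideal.span {(X : k[X][X])})
          ⊗[k[X][X]] VGr V 0),
        Φ (FrobAlg.of p k[X][X] _ (Ideal.Quotient.mk (Ideal.span {X}) a) • z) = a • Φ z := by
  rintro ⟨Φ, hΦ⟩
  obtain ⟨g₀, γ, h1, hX, hγ⟩ := exists_vGr_zero_generator Θ V hV
  obtain ⟨β, hβ⟩ := exists_tensor_pairing (p := p) γ hγ
  have h := hΦ (C X) (FrobAlg.of p k[X][X] _ (Ideal.Quotient.mk (Ideal.span {X}) 1) ⊗ₜ g₀)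
  rw [hX, EmbeddingLike.map_eq_zero_iff, TensorProduct.smul_tmul', smul_eq_mul, ← map_mul,
    ← map_mul, mul_one] at h
  have h2 := hβ (C X) g₀
  rw [h, map_zero, h1] at h2
  simp at h2

end filtration

section cartierGraded

/-! ### The graded piece `Gr^1` of the Cartier module `i_* ω_R` -/

/-- If `κ f ^ n` preserves `T'` and `T`, then it induces a Cartier structure on `T' / T`. -/
theorem exists_isInducedCartier {p : ℕ} {R A M : Type*} [CommRing R] [CommRing A] [AddCommGroup M]
    [Module A M] [Algebra R A] [Module R M] [IsScalarTower R A M] (κ : CartierMap p A M) (f : A)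
    (n : ℕ) (T' T : Submodule A M) (h' : ∀ m ∈ T', κ (f ^ n • m) ∈ T')
    (h : ∀ m ∈ T, κ (f ^ n • m) ∈ T) :
    ∃ κ₁ : CartierMap p R (SubQuotient T' T), IsInducedCartier κ f n T' T κ₁ := by
  let φ : T' →+ T' :=
    { toFun := fun m => ⟨κ (f ^ n • (m : M)), h' m m.2⟩
      map_zero' := by simp
      map_add' := fun m m' => by simp }
  refine ⟨{ QuotientAddGroup.map _ _ φ (fun m hm => h _ hm) with
            map_pow_smul' := fun a q => ?_ }, fun m => ⟨h' m m.2, rfl⟩⟩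
  obtain ⟨m, rfl⟩ := SubQuotient.mk_surjective T' T q
  change SubQuotient.mk T' T (φ (a ^ p • m)) = SubQuotient.mk T' T (a • φ m)
  congr 1
  refine Subtype.ext ?_
  change κ (f ^ n • (a ^ p • (m : M))) = a • κ (f ^ n • (m : M))
  rw [← algebraMap_smul A (a ^ p), map_pow, smul_comm, κ.map_pow_smul, algebraMap_smul]

/-- The additive quotient map `T' → T' / T`. -/
def SubQuotient.mkHom {A M : Type*} [CommRing A] [AddCommGroup M] [Module A M]
    (T' T : Submodule A M) : T' →+ SubQuotient T' T where
  toFun := SubQuotient.mk T' T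
  map_zero' := map_zero (T.submoduleOf T').mkQ
  map_add' := map_add (T.submoduleOf T').mkQ

theorem SubQuotient.mk_eq_zero {A M : Type*} [CommRing A] [AddCommGroup M] [Module A M]
    (T' T : Submodule A M) (m : T') : SubQuotient.mk T' T m = 0 ↔ (m : M) ∈ T :=
  Submodule.Quotient.mk_eq_zero (T.submoduleOf T')

variable {p : ℕ} [hp : Fact p.Prime] {k : Type*} [Field k] [CharP k p]

/-- `x` kills `Gr^1 = k[x] ⧸ (x)`, hence the image of `Gr^1 → F^! Gr^1`, but it does not kill
`r dx ↦ [κ(r dx)]` in `F^! Gr^1`. -/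
theorem not_surjective_adjoint_graded {κ : CartierMap p k k} {u : k} (hu : κ u ≠ 0)
    {T' T : Submodule k[X][X] (GraphOmega k)} (hT' : ∀ m, m ∈ T')
    (hT : ∀ m, m ∈ T ↔ X ∣ GraphOmega.coord k m) (κ₁ : CartierMap p k[X] (SubQuotient T' T)) :
    ¬ Function.Surjective κ₁.adjoint := by
  let j : k[X] →+ T' :=
    (GraphOmega.coord k).symm.toLinearMap.toAddMonoidHom.codRestrict T' fun r => hT' _
  let q : k[X] →+ SubQuotient T' T := (SubQuotient.mkHom T' T).comp j
  have hqsmul : ∀ a r : k[X], q (a * r) = a • q r := fun a r => by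
    have h : j (a * r) = a • j r :=
      Subtype.ext (map_smul (GraphOmega.coord k).symm a r)
    exact (congrArg (SubQuotient.mk T' T) h).trans (SubQuotient.smul_mk T' T a _).symm
  have hqzero : ∀ r : k[X], q r = 0 ↔ X ∣ r := fun r => by
    refine (SubQuotient.mk_eq_zero T' T (j r)).trans ((hT _).trans ?_)
    rw [show (j r : GraphOmega k) = (GraphOmega.coord k).symm r from rfl,
      LinearEquiv.apply_symm_apply]
  have hqsurj : Function.Surjective q := fun z => by
    obtain ⟨m, rfl⟩ := SubQuotient.mk_surjective T' T z
    have h : j (GraphOmega.coord k m) = m :=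
      Subtype.ext ((GraphOmega.coord k).symm_apply_apply _)
    exact ⟨GraphOmega.coord k m, congrArg (SubQuotient.mk T' T) h⟩
  intro hsurj
  -- `q ∘ κ` is the element `r dx ↦ [κ(r dx)]` of `F^! Gr^1`; were it the image of `z`, it would
  -- vanish at `x ^ (p - 1) u`, as `x z = 0`.
  obtain ⟨z, hz⟩ := hsurj ⟨q.comp (lineCartier κ).toAddMonoidHom, fun a b => by
    change q (lineCartier κ (a ^ p ^ 1 * b)) = a • q (lineCartier κ b)
    rw [pow_one, ← smul_eq_mul, CartierMap.map_pow_smul, smul_eq_mul, hqsmul]⟩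
  have hz' : ∀ b : k[X], κ₁ (b • z) = q (lineCartier κ b) := fun b => DFunLike.congr_fun hz b
  have h1 : κ₁ ((X ^ (p - 1) * C u) • z) = 0 := by
    obtain ⟨r, rfl⟩ := hqsurj z
    have h2 : p - 1 ≠ 0 := Nat.sub_ne_zero_of_lt hp.out.one_lt
    rw [← hqsmul, (hqzero _).2, map_zero]
    exact ((dvd_pow_self X h2).mul_right _).mul_right _
  rw [hz', hqzero, X_dvd_iff, CartierMap.coeff_lineCartier, zero_add, mul_one, coeff_mul_C,
    coeff_X_pow_self, one_mul] at h1
  exact hu h1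

theorem graphOmega_smul_X_pow_mem {κ : CartierMap p k k} {T : Submodule k[X][X] (GraphOmega k)}
    (hT : ∀ m, m ∈ T ↔ X ∣ GraphOmega.coord k m) (m : GraphOmega k) (hm : m ∈ T) :
    graphOmega κ ((X : k[X][X]) ^ (p - 1) • m) ∈ T := by
  obtain ⟨r, hr⟩ := (hT m).1 hm
  rw [hT, GraphOmega.coord_graphOmega, GraphOmega.coord_smul, hr, eval_pow, eval_X, ← mul_assoc,
    ← pow_succ, Nat.sub_add_cancel hp.out.one_le, ← smul_eq_mul, CartierMap.map_pow_smul]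
  exact dvd_mul_right _ _

end cartierGraded

section ideals

/-! ### Ideal membership -/

variable {p : ℕ} [hp : Fact p.Prime] {k : Type*} [Field k] [CharP k p]

/-- The ideal `(g, h)` lies in the kernel of `t ↦ r`, which does not contain `x ^ n`. -/
theorem C_X_pow_notMem_span_pair (n : ℕ) (r : k[X]) (g h : k[X][X]) (hg : g.eval r = 0)
    (hh : h.eval r = 0) : (C X : k[X][X]) ^ n ∉ Ideal.span {g, h} := by
  intro hmem
  have hle : Ideal.span {g, h} ≤ RingHom.ker (evalRingHom r) := by
    rw [Ideal.span_le]
    rintro _ (rfl | rfl)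
    exacts [hg, hh]
  have h1 : ((C X : k[X][X]) ^ n).eval r = 0 := hle hmem
  rw [eval_pow, eval_C] at h1
  exact pow_ne_zero _ X_ne_zero h1

end ideals

section graphUnit

/-! ### `ℳ ⊗ ω⁻¹` as a unit `F`-module, and its test module filtration -/

variable {p : ℕ} [Fact p.Prime] {k : Type*} [Field k] [CharP k p]

/-- The unit `F`-module `ℳ ⊗ ω⁻¹` is `i_+ R` with the Frobenius of `R[t]_{x - t}`. -/
theorem exists_graphUnit_equiv (hk : (frobenius k p).Finite) (κ : CartierMap p k k)
    (hκ : Function.Bijective κ.adjoint) :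
    Function.Bijective (graphOmega κ).colimAdjoint ∧
      ∃ ψ : (graphOmega κ).Colim ≃ₗ[k[X][X]] IPlus k,
        (∀ m, ψ ((graphOmega κ).toColim m) = IPlus.frac (C (GraphOmega.coord k m))) ∧
        IsAdjointStructuralMap (omegaPlane κ) (graphOmega κ).colim
          (graphFrob (evalGenEquiv k ψ)) ∧
        IsUnitFModule (graphFrob (evalGenEquiv k ψ)) := by
  obtain ⟨d, b, c, hb⟩ := CartierMap.exists_isDualBasis hk κ hκ.2
  have hdual := AwayQuotient.isFrobeniusDual (f := xSubT k) xSubT_ne_zero hb.line.line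
  have hN : Function.Bijective (IPlus.cartier κ).adjoint := hdual.adjoint_bijective hb.line.line
  obtain ⟨ψ, hψM, hψ⟩ := exists_colim_graphOmega_equiv κ hN
  exact ⟨(graphOmega κ).colimAdjoint_bijective_of_equiv _ hN ψ hψ, ψ, hψM,
    isAdjointStructuralMap_graphFrob hdual ψ hψ,
    (hdual.isUnitFModule hb.line.line).of_equiv _ _ (apply_graphFrob _)⟩

theorem map_graphTest {κ : CartierMap p k k} {u : k} (hu : κ u ≠ 0)
    (ψ : (graphOmega κ).Colim ≃ₗ[k[X][X]] IPlus k)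
    (hψ : ∀ m, ψ ((graphOmega κ).toColim m) = IPlus.frac (C (GraphOmega.coord k m)))
    {s : ℚ} (hs : 0 ≤ s) :
    (graphTest κ s).map (evalGenEquiv k ψ).toLinearMap =
      Submodule.span k[X][X] {IPlus.frac ((C X : k[X][X]) ^ ⌊s⌋₊)} := by
  ext ν
  constructor
  · rintro ⟨n, hn, rfl⟩
    exact (mem_graphTest_iff hu ψ hψ hs n).1 hn
  · intro hν
    refine ⟨(evalGenEquiv k ψ).symm ν, (mem_graphTest_iff hu ψ hψ hs _).2 ?_,
      LinearEquiv.apply_symm_apply _ _⟩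
    rwa [LinearEquiv.apply_symm_apply]

/-- The natural map `Gr^1 → F^! Gr^1` is not surjective. -/
theorem exists_inducedCartier_not_surjective {κ : CartierMap p k k} {u : k} (hu : κ u ≠ 0) {ε : ℚ}
    (hε : 0 ≤ 1 - ε ∧ ⌊1 - ε⌋₊ = 0) :
    ∃ κ₁ : CartierMap p k[X] (SubQuotient ((graphOmega κ).testModule X (1 - ε))
        ((graphOmega κ).testModule X 1)),
      IsInducedCartier (graphOmega κ) X (p - 1) _ _ κ₁ ∧ ¬ Function.Surjective κ₁.adjoint := by
  have h1 := (graphOmega_isLeast_testModule hu hε.1).2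
  have h2 := (graphOmega_isLeast_testModule (κ := κ) hu zero_le_one).2
  simp only [hε.2, pow_zero, one_dvd, iff_true] at h1
  simp only [Nat.floor_one, pow_one] at h2
  obtain ⟨κ₁, hκ₁⟩ := exists_isInducedCartier (R := k[X]) (graphOmega κ) X (p - 1)
    ((graphOmega κ).testModule X (1 - ε)) ((graphOmega κ).testModule X 1) (fun m _ => h1 _)
    (graphOmega_smul_X_pow_mem h2)
  exact ⟨κ₁, hκ₁, not_surjective_adjoint_graded hu h1 h2 κ₁⟩

end graphUnit

end

theorem mainTheorem6 (p : ℕ) [Fact p.Prime] (k : Type*) [Field k] [CharP k p]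
    (hk : (frobenius k p).Finite) (κ : CartierMap p k k) (hκ : Function.Bijective κ.adjoint) :
    -- the test modules of `i_* ω_R` and of `ω_R`
    (∀ s : ℚ, 0 ≤ s →
      IsLeast ((graphOmega κ).testCandidates X s) ((graphOmega κ).testModule X s) ∧
      IsLeast ((omegaLine κ).testCandidates X s) ((omegaLine κ).testModule X s) ∧
      (∀ m : Ω[k[X]⁄k], GraphOmega.of k m ∈ (graphOmega κ).testModule X s ↔
        m ∈ (omegaLine κ).testModule X s) ∧
      (graphOmega κ).testModule X s =
        Ideal.span {(C X : k[X][X]) ^ ⌊s⌋₊} • (⊤ : Submodule k[X][X] (GraphOmega k))) ∧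
    -- the unit Cartier module, and the unit `F`-module with its structural map `α`
    Function.Bijective (graphOmega κ).colimAdjoint ∧
    (∃ α : GraphUnit κ →ₛₗ[frobenius k[X][X] p] GraphUnit κ,
      IsAdjointStructuralMap (omegaPlane κ) (graphOmega κ).colim α ∧
      IsUnitFModule α ∧
      -- its explicit description, and that of the test module filtration
      (∃ Θ : GraphUnit κ ≃ₗ[k[X][X]] IPlus k,
        (∀ (n : GraphUnit κ) (z : Localization.Away (xSubT k)),
          Θ n = IPlus.mk k z → Θ (α n) = IPlus.mk k (z ^ p)) ∧
        (∀ (n : GraphUnit κ) (r : k[X]),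
          n (omegaPlaneGen k) =
            (graphOmega κ).toColim (GraphOmega.of k (r • KaehlerDifferential.D k k[X] X)) →
          Θ n = IPlus.frac (C r)) ∧
        (∀ s : ℚ, 0 ≤ s → (graphTest κ s).map Θ.toLinearMap =
          Submodule.span k[X][X] {IPlus.frac ((C X : k[X][X]) ^ ⌊s⌋₊)}) ∧
        (∀ s : ℚ, -1 < s → ∀ᶠ ε : ℚ in nhdsWithin 0 (Set.Ioi 0),
          (graphTest κ (s + 1 - ε)).map Θ.toLinearMap =
            Submodule.span k[X][X] {IPlus.frac ((C X : k[X][X]) ^ ⌈s⌉₊)})) ∧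
      -- no filtration that agrees with the shifted test module filtration is a `V`-filtration
      (∀ V : ℚ → Submodule k[X][X] (GraphUnit κ),
        (∀ s : ℚ, 0 ≤ s → ∀ᶠ ε : ℚ in nhdsWithin 0 (Set.Ioi 0), V s = graphTest κ (s + 1 - ε)) →
        ¬ IsSuperSpecializing α X V ∧
        (∀ s : ℕ, ¬ VFrobeniusStable α V s) ∧
        ¬ VFrobeniusGraded α (Ideal.span {X}) V 0 ∧
        Nontrivial (VGr V 0) ∧
        ¬ ∃ Φ : FrobAlg p k[X][X] (k[X][X] ⧸ Ideal.span {(X : k[X][X])}) ⊗[k[X][X]] VGr V 0 ≃+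
              VGr V 0,
            ∀ (a : k[X][X]) (z : FrobAlg p k[X][X] (k[X][X] ⧸ Ideal.span {(X : k[X][X])})
                ⊗[k[X][X]] VGr V 0),
              Φ (FrobAlg.of p k[X][X] _ (Ideal.Quotient.mk (Ideal.span {X}) a) • z) = a • Φ z)) ∧
    -- the ideal membership that axiom (iii) would require
    (∀ s : ℕ,
      (C X : k[X][X]) ^ (s * p) ∉ Ideal.span
        {(C X : k[X][X]) ^ p - X ^ p, (C X : k[X][X]) ^ (s * p) * (C X - X) ^ (p - 1)} ∧
      (C X : k[X][X]) ^ (s * p) ∉ Ideal.span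
        {(X : k[X][X]) ^ p, (C X : k[X][X]) ^ (s * p) * X ^ (p - 1)}) ∧
    -- the natural map `Gr^1 → F^! Gr^1` over `k[x]`
    (∀ᶠ ε : ℚ in nhdsWithin 0 (Set.Ioi 0),
      ∃ κ₁ : CartierMap p k[X] (SubQuotient ((graphOmega κ).testModule X (1 - ε))
          ((graphOmega κ).testModule X 1)),
        IsInducedCartier (graphOmega κ) X (p - 1) _ _ κ₁ ∧ ¬ Function.Surjective κ₁.adjoint) := by
  have hp : p - 1 ≠ 0 := Nat.sub_ne_zero_of_lt (Fact.out : p.Prime).one_lt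
  have hu := CartierMap.exists_apply_ne_zero hκ.1
  have hunit := exists_graphUnit_equiv hk κ hκ
  refine ⟨fun s hs => ?_, hunit.1, ?_, fun s => ⟨?_, ?_⟩, ?_⟩
  · obtain ⟨u, hu⟩ := hu
    obtain ⟨h1, h2⟩ := graphOmega_isLeast_testModule hu hs
    obtain ⟨h3, h4⟩ := omegaLine_isLeast_testModule hu hs
    refine ⟨h1, h3, fun m => ?_, Submodule.ext fun m => ?_⟩
    · rw [h2, h4, GraphOmega.coord_of]
    · rw [h2, mem_span_C_X_pow_smul_top]
  · obtain ⟨u, hu⟩ := hu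
    obtain ⟨-, ψ, hψ, hadj, hF⟩ := hunit
    have hα := apply_graphFrob (evalGenEquiv k ψ)
    refine ⟨graphFrob (evalGenEquiv k ψ), hadj, hF,
      ⟨evalGenEquiv k ψ, fun n z h => ?_, fun n r h => ?_, fun s hs => map_graphTest hu ψ hψ hs,
        fun s hs => ?_⟩, fun V hV => ?_⟩
    · rw [hα, h]
      rfl
    · rw [evalGenEquiv_apply, h, hψ, GraphOmega.coord_of, map_smul,
        KaehlerDifferential.polynomialEquiv_D, derivative_X, smul_eq_mul, mul_one]
    · filter_upwards [eventually_floor_add_one_sub s hs] with ε hε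
      rw [map_graphTest hu ψ hψ hε.1, hε.2]
    · have hV' : ∀ s : ℚ, 0 ≤ s → ∀ n, n ∈ V s ↔ evalGenEquiv k ψ n ∈
          Submodule.span k[X][X] {IPlus.frac ((C X : k[X][X]) ^ ⌈s⌉₊)} := by
        intro s hs n
        obtain ⟨ε, h1, h2, h3⟩ :=
          ((hV s hs).and (eventually_floor_add_one_sub s (by linarith))).exists
        rw [h1, mem_graphTest_iff hu ψ hψ h2, h3]
      have hstable := not_vFrobeniusStable _ V hV' _ hα
      exact ⟨fun h => hstable 0 (h.frobenius_stable _), hstable,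
        not_vFrobeniusGraded _ V hV' _ hα, nontrivial_vGr_zero _ V hV',
        not_exists_frobenius_pullback_equiv _ V hV'⟩
  · exact C_X_pow_notMem_span_pair _ X _ _ (by simp) (by simp [hp])
  · exact C_X_pow_notMem_span_pair _ 0 _ _ (by simp [(Fact.out : p.Prime).ne_zero]) (by simp [hp])
  · obtain ⟨u, hu⟩ := hu
    filter_upwards [eventually_floor_add_one_sub 0 (by norm_num)] with ε hε
    rw [zero_add, Nat.ceil_zero] at hε
    exact exists_inducedCartier_not_surjective hu hε
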